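/- Let $K$ be an algebraically closed field of characteristic zero, $n\ge 0$, $R=K[x_1,\dots,x_{n+1}]$ the homogeneous coordinate ring of $\mathbb P^n$, and let $I\subset R$ be the homogeneous ideal of a set of $r$ distinct points of $\mathbb P^n$. For $m\ge 1$ let $I^{(m)}=R\cap\bigcap_{Q\in\mathrm{Ass}(I)}(I^m)_Q$ be the $m$-th symbolic power of $I$. Let $\mathrm{HP}_{J}$ denote the Hilbert polynomial of a homogeneous ideal $J$, i.e. the polynomial that agrees with $t\mapsto\dim_K(R_t/J_t)$ for all large integers $t$, and let $\mathrm{gin}(J)$ be its generic initial ideal, i.e. the initial ideal of $gJ$ with respect to the degree reverse lexicographic order, for $g$ in a nonempty Zariski open subset of $GL_{n+1}(K)$ on which this initial ideal is constant. Define the asymptotic Hilbert polynomial of $I$ by $$\mathrm{aHP}_I(t)=\lim_{m\to\infty}\frac{\mathrm{HP}_{I^{(m)}}(mt)}{m^n}.$$ For $m\ge1$ put $$L_m=\bigcup\{\alpha+\mathbb R^n_{\ge0}\;:\;\alpha\in\mathbb Z_{\ge0}^n,\ x_1^{\alpha_1}\cdots x_n^{\alpha_n}\in\mathrm{gin}(I^{(m)})\}\subset\mathbb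 R^n,$$ and $$\Gamma(I)=\overline{\bigcap_{m\ge1}\Bigl(\mathbb R^n_{\ge0}\setminus\tfrac1m\,\mathrm{conv}(L_m)\Bigr)}.$$ Then all these objects are well defined (the Hilbert polynomials and generic initial ideals of all $I^{(m)}$, $m\ge1$, exist, and the limit defining $\mathrm{aHP}_I(t)$ exists for every real $t$), and for every real $t$ $$\mathrm{aHP}_I(t)=\frac{r}{n!}=\mathrm{vol}(\Gamma(I)),$$ where $\mathrm{vol}$ is Lebesgue measure on $\mathbb R^n$. -/

import Mathlib

open scoped Pointwise LinearAlgebra.Projectivization Nat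

noncomputable section

namespace LimitingShape

/-- The homogeneous coordinate ring of projective `n`-space; the variable `X (Fin.last n)` is the
last one. -/
abbrev CoordRing (K : Type*) [Field K] (n : ℕ) := MvPolynomial (Fin (n + 1)) K

/-- The homogeneous ideal of a finite set `S` of points of projective `n`-space: it is generated by
the forms vanishing at every point of `S` (for a form, vanishing does not depend on the choice of
homogeneous coordinates). -/
def pointsIdeal {K : Type*} [Field K] {n : ℕ} (S : Finset (ℙ K (Fin (n + 1) → K))) :
    Ideal (CoordRing K n) :=
  Ideal.span {f | ∃ d : ℕ, f.IsHomogeneous d ∧ ∀ p ∈ S, MvPolynomial.eval p.rep f = 0}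

/-- The `m`-th symbolic power: the elements of `R` lying in the localization of `I ^ m` at every
associated prime `Q` of `I` (that is, of `R ⧸ I`). -/
def symbolicPower {R : Type*} [CommRing R] (I : Ideal R) (m : ℕ) : Ideal R :=
  ⨅ (Q : Ideal R) (hQ : Q ∈ associatedPrimes R (R ⧸ I)),
    haveI : Q.IsPrime := IsAssociatedPrime.isPrime hQ
    ((I ^ m).map (algebraMap R (Localization.AtPrime Q))).comap
      (algebraMap R (Localization.AtPrime Q))

/-- The Hilbert function `t ↦ dim_K (R_t / J_t)`. -/
def hilbertFunction {K : Type*} [Field K] {n : ℕ} (J : Ideal (CoordRing K n)) (t : ℕ) : ℕ :=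
  Module.finrank K
    (MvPolynomial.homogeneousSubmodule (Fin (n + 1)) K t ⧸
      (J.restrictScalars K).submoduleOf (MvPolynomial.homogeneousSubmodule (Fin (n + 1)) K t))

/-- `P` is the Hilbert polynomial of `J`: it agrees with the Hilbert function in large degrees. -/
def IsHilbertPolynomial {K : Type*} [Field K] {n : ℕ} (J : Ideal (CoordRing K n))
    (P : Polynomial ℚ) : Prop :=
  ∀ᶠ t : ℕ in Filter.atTop, P.eval (t : ℚ) = (hilbertFunction J t : ℚ)

/-- There is at most one Hilbert polynomial. -/
theorem IsHilbertPolynomial.unique {K : Type*} [Field K] {n : ℕ} {J : Ideal (CoordRing K n)}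
    {P Q : Polynomial ℚ} (hP : IsHilbertPolynomial J P) (hQ : IsHilbertPolynomial J Q) :
    P = Q := by
  obtain ⟨N, hN⟩ := Filter.eventually_atTop.1 (hP.and hQ)
  refine Polynomial.eq_of_infinite_eval_eq P Q ?_
  refine Set.Infinite.mono ?_ ((Set.Ici_infinite N).image (Nat.cast_injective (R := ℚ)).injOn)
  rintro _ ⟨t, ht, rfl⟩
  exact (hN t ht).1.trans (hN t ht).2.symm

open Classical in
/-- The Hilbert polynomial (`0` if there is none). -/
def hilbertPolynomial {K : Type*} [Field K] {n : ℕ} (J : Ideal (CoordRing K n)) : Polynomial ℚ :=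
  if h : ∃ P, IsHilbertPolynomial J P then h.choose else 0

/-- The sequence `m ↦ HP_{I^(m)}(m t) / m ^ n`. -/
def aHPSeq {K : Type*} [Field K] {n : ℕ} (I : Ideal (CoordRing K n)) (t : ℝ) (m : ℕ) : ℝ :=
  Polynomial.aeval ((m : ℝ) * t) (hilbertPolynomial (symbolicPower I m)) / (m : ℝ) ^ n

/-- The asymptotic Hilbert polynomial of `I`, as a function of `t`: the limit of
`HP_{I^(m)}(m t) / m ^ n` as `m → ∞`. -/
def aHP {K : Type*} [Field K] {n : ℕ} (I : Ideal (CoordRing K n)) (t : ℝ) : ℝ :=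
  Filter.limUnder Filter.atTop (aHPSeq I t)

/-- The strict degree reverse lexicographic order on exponents: `α < β` if `|α| < |β|`, or
`|α| = |β|` and, at the last index where they differ, `α` has the larger exponent. -/
def DegRevLexLT {n : ℕ} (α β : Fin (n + 1) →₀ ℕ) : Prop :=
  α.degree < β.degree ∨
    (α.degree = β.degree ∧ ∃ i, (∀ j, i < j → α j = β j) ∧ β i < α i)

/-- `α` is the exponent of the leading monomial of `f` with respect to degrevlex. -/
def IsLeadingExponent {K : Type*} [Field K] {n : ℕ} (f : CoordRing K n)
    (α : Fin (n + 1) →₀ ℕ) : Prop :=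
  α ∈ f.support ∧ ∀ β ∈ f.support, β ≠ α → DegRevLexLT β α

/-- The initial ideal with respect to degrevlex. -/
def initialIdeal {K : Type*} [Field K] {n : ℕ} (J : Ideal (CoordRing K n)) :
    Ideal (CoordRing K n) :=
  Ideal.span {x | ∃ f ∈ J, ∃ α, IsLeadingExponent f α ∧ x = MvPolynomial.monomial α 1}

/-- The linear change of coordinates `x_j ↦ ∑ i, g i j * x_i`. -/
def coordChange {K : Type*} [Field K] {n : ℕ} (g : GL (Fin (n + 1)) K) :
    CoordRing K n →ₐ[K] CoordRing K n :=
  MvPolynomial.aeval fun j => ∑ i, MvPolynomial.C (g.1 i j) * MvPolynomial.X i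

/-- `M` is the generic initial ideal of `J`: it is the degrevlex initial ideal of `g J` for all `g`
in a nonempty Zariski open subset of `GL`, namely where some nonzero polynomial in the entries of
`g` does not vanish. -/
def IsGenericInitialIdeal {K : Type*} [Field K] {n : ℕ} (J M : Ideal (CoordRing K n)) : Prop :=
  ∃ F : MvPolynomial (Fin (n + 1) × Fin (n + 1)) K, F ≠ 0 ∧
    ∀ g : GL (Fin (n + 1)) K, MvPolynomial.eval (fun ij => g.1 ij.1 ij.2) F ≠ 0 →
      initialIdeal (J.map (coordChange g)) = M

/-- There is at most one generic initial ideal. -/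
theorem IsGenericInitialIdeal.unique {K : Type*} [Field K] [Infinite K] {n : ℕ}
    {J M N : Ideal (CoordRing K n)} (hM : IsGenericInitialIdeal J M)
    (hN : IsGenericInitialIdeal J N) : M = N := by
  obtain ⟨F, hF, hFM⟩ := hM
  obtain ⟨G, hG, hGN⟩ := hN
  have hne : F * G * (Matrix.mvPolynomialX (Fin (n + 1)) (Fin (n + 1)) K).det ≠ 0 :=
    mul_ne_zero (mul_ne_zero hF hG) (Matrix.det_mvPolynomialX_ne_zero _ _)
  obtain ⟨s, hs⟩ : ∃ s, MvPolynomial.eval s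
      (F * G * (Matrix.mvPolynomialX (Fin (n + 1)) (Fin (n + 1)) K).det) ≠ 0 := by
    by_contra! h
    exact hne (MvPolynomial.funext fun s => by rw [h s, map_zero])
  rw [map_mul, map_mul, Matrix.eval_det_mvPolynomialX] at hs
  have hdet := right_ne_zero_of_mul hs
  have hFG := left_ne_zero_of_mul hs
  let g : GL (Fin (n + 1)) K := Matrix.GeneralLinearGroup.mkOfDetNeZero _ hdet
  exact (hFM g (left_ne_zero_of_mul hFG)).symm.trans (hGN g (right_ne_zero_of_mul hFG))

open Classical in
/-- The generic initial ideal (`⊥` if there is none). -/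
def gin {K : Type*} [Field K] {n : ℕ} (J : Ideal (CoordRing K n)) : Ideal (CoordRing K n) :=
  if h : ∃ M, IsGenericInitialIdeal J M then h.choose else ⊥

/-- `gin J` regarded as an ideal in the first `n` variables. -/
def ginTrunc {K : Type*} [Field K] {n : ℕ} (J : Ideal (CoordRing K n)) :
    Ideal (MvPolynomial (Fin n) K) :=
  (gin J).comap (MvPolynomial.rename Fin.castSucc : MvPolynomial (Fin n) K →ₐ[K] CoordRing K n)

/-- The set `L_m`: the union of the orthants `α + ℝ^n_{≥0}` over the monomials `x^α` of
`gin (I^(m))`. -/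
def exponentRegion {K : Type*} [Field K] {n : ℕ} (I : Ideal (CoordRing K n)) (m : ℕ) :
    Set (Fin n → ℝ) :=
  {x | ∃ α : Fin n →₀ ℕ, MvPolynomial.monomial α (1 : K) ∈ ginTrunc (symbolicPower I m) ∧
    ∀ i, (α i : ℝ) ≤ x i}

/-- The set `Γ(I)`: the closure of `⋂_{m ≥ 1} (ℝ^n_{≥0} \ conv(L_m) / m)`. -/
def Γ {K : Type*} [Field K] {n : ℕ} (I : Ideal (CoordRing K n)) : Set (Fin n → ℝ) :=
  closure (⋂ (m : ℕ) (_ : 1 ≤ m),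
    {x | ∀ i, 0 ≤ x i} \ ((m : ℝ)⁻¹ • convexHull ℝ (exponentRegion I m)))

end LimitingShape

end

/-! The ideal `I` is the intersection of the primes `P_p` of the points `p ∈ S`. Powers of `P_p` are
`P_p`-primary, so `I^(m) = ⋂ P_p ^ m` (`symbolicPower_pointsIdeal`). After moving `p` to the last
coordinate point, `P_p ^ m` is spanned by the monomials of degree at least `m` in the first `n`
variables. Hence `R / P_p ^ (k+1)` has Hilbert function `(n+k).choose n` from degree `k` on.
Distinct points impose independent conditions in large degree, so the Hilbert polynomial of
`I^(k+1)` is the constant `r * (n+k).choose n`. Division by `(k+1)^n` gives the limit `r / n!`,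
whatever `t` is.

For the volume, the last variable is, in general coordinates, a nonzerodivisor modulo `I^(m)`, and
degrevlex passes this to the initial ideal (`mem_leadingExponents_of_add_single_last`). So the
exponents in the first `n` variables outside `gin (I^(m))` are finite in number and are counted by
the same Hilbert polynomial (`ncard_compl_ginExponents`). Scaled by `1/m`, they are corners of cubes
of side `1/m` tiling the complement of `L_m / m`, which therefore has volume `r * (n+k).choose n /
(k+1)^n` for `m = k+1`. This is at least `r / n!` and tends to it.

Since `I^(a) I^(b) ⊆ I^(a+b)`, the exponent sets form a graded system. Along `m = k!` the
complements decrease, so continuity of measure gives volume `r / n!` to the complement of `U = ⋃ L_m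
/ m` (`IsGradedSystem.volume_orthant_sdiff_limitRegion`). The same multiplicativity makes the
closure of `U` convex, so taking convex hulls only adds points of that closure. Taking the closure
at the end also changes the set only within the frontier of `U`, which is null because `U` is an
upper set.

Existence of the generic initial ideal is a rank argument: ranks of polynomial families of linear
maps are generically constant, and noetherianity reduces the conditions in all degrees to finitely
many. -/

noncomputable section

namespace LimitingShape

open MvPolynomial

/-! ### The degree reverse lexicographic order -/

section Order

variable {n : ℕ}

/-- An injective map to a linear order inducing the degree reverse lexicographic order. -/
def degRevLexKey (α : Fin (n + 1) →₀ ℕ) : ℕ ×ₗ Lex (Fin (n + 1) → ℕᵒᵈ) :=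
  toLex (α.degree, toLex fun i => OrderDual.toDual (α i.rev))

theorem degRevLexKey_injective : Function.Injective (degRevLexKey (n := n)) := by
  intro α β h
  have h2 := congrArg (fun x => (ofLex x).2) h
  ext i
  have := congrFun (congrArg ofLex h2) i.rev
  simpa [degRevLexKey] using this

/-- Reversing the indices turns the last difference into the first, and dualising the entries makes
the larger exponent the smaller one. -/
theorem degRevLexLT_iff {α β : Fin (n + 1) →₀ ℕ} :
    DegRevLexLT α β ↔ degRevLexKey α < degRevLexKey β := by
  rw [degRevLexKey, degRevLexKey, Prod.Lex.toLex_lt_toLex, DegRevLexLT]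
  refine or_congr Iff.rfl (and_congr Iff.rfl ?_)
  constructor
  · rintro ⟨i, h1, h2⟩
    refine ⟨i.rev, fun j hj => ?_, ?_⟩
    · have : i < j.rev := by rw [Fin.lt_rev_iff]; exact hj
      simp [h1 _ this]
    · simpa using h2
  · rintro ⟨i, h1, h2⟩
    refine ⟨i.rev, fun j hj => ?_, ?_⟩
    · have : j.rev < i := by rw [Fin.rev_lt_iff]; exact hj
      have := h1 _ this
      simpa using this
    · simpa using h2

theorem DegRevLexLT.add_right {α β : Fin (n + 1) →₀ ℕ} (h : DegRevLexLT α β)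
    (γ : Fin (n + 1) →₀ ℕ) : DegRevLexLT (α + γ) (β + γ) := by
  rcases h with h | ⟨h, i, h1, h2⟩
  · left; simpa using h
  · right
    refine ⟨by simp [h], i, fun j hj => by simp [h1 j hj], by simpa using h2⟩

theorem DegRevLexLT.trans {α β γ : Fin (n + 1) →₀ ℕ} (h : DegRevLexLT α β)
    (h' : DegRevLexLT β γ) : DegRevLexLT α γ := by
  rw [degRevLexLT_iff] at *; exact h.trans h'

theorem DegRevLexLT.irrefl (α : Fin (n + 1) →₀ ℕ) : ¬ DegRevLexLT α α := by
  rw [degRevLexLT_iff]; exact lt_irrefl _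

/-- The exponents of degree `d`. -/
@[ext] structure DegExp (n d : ℕ) where
  /-- The exponent. -/
  val : Fin (n + 1) →₀ ℕ
  degree_val : val.degree = d

/-- The degree reverse lexicographic order on the exponents of a given degree. -/
instance degRevLexLinearOrder (d : ℕ) : LinearOrder (DegExp n d) :=
  LinearOrder.lift' (fun α => degRevLexKey α.val) fun _ _ h => DegExp.ext (degRevLexKey_injective h)

theorem lt_iff_degRevLexLT {d : ℕ} {α β : DegExp n d} : α < β ↔ DegRevLexLT α.1 β.1 := by
  rw [degRevLexLT_iff]; exact Iff.rfl

/-- The exponents of degree `d` as a finite set. -/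
def degExpEquiv (n d : ℕ) :
    DegExp n d ≃ (Finset.univ : Finset (Fin (n + 1))).finsuppAntidiag d where
  toFun α := ⟨α.1, by
    simpa [Finset.mem_finsuppAntidiag, Finsupp.degree_eq_sum] using α.2⟩
  invFun α := ⟨α.1, by
    have h := α.2
    rw [Finset.mem_finsuppAntidiag] at h
    rw [Finsupp.degree_eq_sum]; exact h.1⟩
  left_inv _ := rfl
  right_inv _ := rfl

instance fintype_degExp (d : ℕ) : Fintype (DegExp n d) :=
  Fintype.ofEquiv _ (degExpEquiv n d).symm

theorem card_degExp (n d : ℕ) : Nat.card (DegExp n d) = (n + d).choose n := by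
  rw [Nat.card_congr (degExpEquiv n d), Nat.card_eq_fintype_card, Fintype.card_coe,
    Finset.card_finsuppAntidiag_nat_eq_choose]
  simp only [Finset.card_univ, Fintype.card_fin]
  rw [show n + 1 + d - 1 = n + d by omega, Nat.choose_symm_add]

end Order

/-! ### Dimension and leading indices -/

/-- The dimension of a space of vectors is the number of indices at which one of them has its
last nonzero coordinate. -/
theorem finrank_range_eq_card_leading {K W ι : Type*} [Field K] [AddCommGroup W] [Module K W]
    [Fintype ι] [LinearOrder ι] (c : W →ₗ[K] ι → K) :
    Module.finrank K (LinearMap.range c) =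
      Nat.card {i : ι // ∃ w, c w i ≠ 0 ∧ ∀ j, i < j → c w j = 0} := by
  classical
  set L := {i : ι // ∃ w, c w i ≠ 0 ∧ ∀ j, i < j → c w j = 0} with hL
  apply le_antisymm
  -- Upper bound: a nonzero vector of the range is nonzero at its own last nonzero coordinate, which
  -- lies in `L`, so restriction to `L` is injective.
  · let ρ : LinearMap.range c →ₗ[K] (L → K) :=
      (LinearMap.funLeft K K (Subtype.val : L → ι)).comp (LinearMap.range c).subtype
    have hρ : Function.Injective ρ := by
      rw [← LinearMap.ker_eq_bot, LinearMap.ker_eq_bot']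
      rintro ⟨_, w, rfl⟩ h
      by_contra hne
      have hne' : ∃ i, c w i ≠ 0 := by
        by_contra! h0
        exact hne (Subtype.ext (funext h0))
      have hs : (Finset.univ.filter fun i => c w i ≠ 0).Nonempty := by
        obtain ⟨i, hi⟩ := hne'; exact ⟨i, by simpa using hi⟩
      set i := Finset.max' _ hs with hi
      have hi1 : c w i ≠ 0 := by simpa using Finset.max'_mem _ hs
      have hi2 : ∀ j, i < j → c w j = 0 := by
        intro j hj
        by_contra hj0
        exact absurd (Finset.le_max' (Finset.univ.filter fun i => c w i ≠ 0) j (by simpa using hj0))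
          (not_le.2 hj)
      exact hi1 (congrFun h ⟨i, w, hi1, hi2⟩)
    have := LinearMap.finrank_le_finrank_of_injective hρ
    rwa [Module.finrank_fintype_fun_eq_card, ← Nat.card_eq_fintype_card] at this
  -- Lower bound: one vector for each leading index gives a triangular matrix with nonzero diagonal.
  · choose w hw1 hw2 using fun i : L => i.2
    let M : Matrix L L K := Matrix.of fun i j => c (w i) j.1
    have hM : M.BlockTriangular OrderDual.toDual := by
      intro i j hij
      exact hw2 i j.1 hij
    have hdet : M.det ≠ 0 := by
      rw [Matrix.det_of_isLowerTriangular M hM]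
      exact Finset.prod_ne_zero_iff.2 fun i _ => hw1 i
    have hli : LinearIndependent K fun i => M i :=
      Matrix.linearIndependent_rows_of_det_ne_zero hdet
    have hli2 : LinearIndependent K fun i : L => (⟨c (w i), w i, rfl⟩ : LinearMap.range c) := by
      refine LinearIndependent.of_comp ((LinearMap.funLeft K K (Subtype.val : L → ι)).comp
        (LinearMap.range c).subtype) ?_
      exact hli
    have := hli2.fintype_card_le_finrank
    rwa [← Nat.card_eq_fintype_card] at this

/-! ### Leading exponents of an ideal -/

section Leading

variable {K : Type*} [Field K] {n : ℕ}

/-- The set of leading exponents of the elements of an ideal. -/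
def leadingExponents (J : Ideal (CoordRing K n)) : Set (Fin (n + 1) →₀ ℕ) :=
  {α | ∃ f ∈ J, IsLeadingExponent f α}

theorem initialIdeal_eq_span (J : Ideal (CoordRing K n)) :
    initialIdeal J = Ideal.span ((fun α => monomial α (1 : K)) '' leadingExponents J) := by
  rw [initialIdeal]
  congr 1
  ext x
  constructor
  · rintro ⟨f, hf, α, h, rfl⟩; exact ⟨α, ⟨f, hf, h⟩, rfl⟩
  · rintro ⟨α, ⟨f, hf, h⟩, rfl⟩; exact ⟨f, hf, α, h, rfl⟩

/-- The order is compatible with addition, so among pairs from the two supports only `(α, β)` has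
sum `α + β`, and no cancellation occurs there. -/
theorem IsLeadingExponent.mul {f g : CoordRing K n} {α β : Fin (n + 1) →₀ ℕ}
    (hf : IsLeadingExponent f α) (hg : IsLeadingExponent g β) :
    IsLeadingExponent (f * g) (α + β) := by
  classical
  have key : ∀ a ∈ f.support, ∀ b ∈ g.support, (a, b) ≠ (α, β) → DegRevLexLT (a + b) (α + β) := by
    intro a ha b hb hab
    by_cases h1 : a = α
    · subst h1
      have h2 : b ≠ β := fun h => hab (by rw [h])
      rw [add_comm a b, add_comm a β]
      exact (hg.2 b hb h2).add_right a
    · have h3 := (hf.2 a ha h1).add_right b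
      by_cases h2 : b = β
      · rw [h2] at h3 ⊢; exact h3
      · have h4 := (hg.2 b hb h2).add_right α
        rw [add_comm b, add_comm β] at h4
        exact h3.trans h4
  have hc : coeff (α + β) (f * g) = coeff α f * coeff β g := by
    rw [coeff_mul]
    refine Finset.sum_eq_single (α, β) ?_ ?_
    · rintro ⟨a, b⟩ hab hne
      by_contra h0
      have h1 := key a (mem_support_iff.2 (left_ne_zero_of_mul h0)) b
        (mem_support_iff.2 (right_ne_zero_of_mul h0)) hne
      rw [show a + b = α + β by simpa using hab] at h1
      exact DegRevLexLT.irrefl _ h1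
    · intro h; simp at h
  refine ⟨?_, ?_⟩
  · rw [mem_support_iff, hc]
    exact mul_ne_zero (mem_support_iff.1 hf.1) (mem_support_iff.1 hg.1)
  · intro γ hγ hne
    obtain ⟨a, ha, b, hb, rfl⟩ := Finset.mem_add.1 (support_mul f g hγ)
    refine key a ha b hb ?_
    rintro h
    obtain ⟨rfl, rfl⟩ := Prod.mk.inj h
    exact hne rfl

theorem isLeadingExponent_monomial (α : Fin (n + 1) →₀ ℕ) :
    IsLeadingExponent (monomial α (1 : K)) α := by
  classical
  refine ⟨by simp [mem_support_iff], fun β hβ hne => ?_⟩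
  simp [mem_support_iff, coeff_monomial] at hβ
  exact absurd hβ.symm hne

theorem add_mem_leadingExponents {J J' J'' : Ideal (CoordRing K n)} (h : J * J' ≤ J'')
    {α β : Fin (n + 1) →₀ ℕ}
    (hα : α ∈ leadingExponents J) (hβ : β ∈ leadingExponents J') :
    α + β ∈ leadingExponents J'' := by
  obtain ⟨f, hf, h1⟩ := hα
  obtain ⟨g, hg, h2⟩ := hβ
  exact ⟨f * g, h (Ideal.mul_mem_mul hf hg), h1.mul h2⟩

theorem leadingExponents_mono_le {J : Ideal (CoordRing K n)} {α β : Fin (n + 1) →₀ ℕ}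
    (hα : α ∈ leadingExponents J) (h : α ≤ β) : β ∈ leadingExponents J := by
  obtain ⟨γ, rfl⟩ := le_iff_exists_add.1 h
  obtain ⟨f, hf, h1⟩ := hα
  exact ⟨f * monomial γ 1, J.mul_mem_right _ hf, h1.mul (isLeadingExponent_monomial γ)⟩

theorem monomial_mem_initialIdeal_iff {J : Ideal (CoordRing K n)} {α : Fin (n + 1) →₀ ℕ} :
    monomial α (1 : K) ∈ initialIdeal J ↔ α ∈ leadingExponents J := by
  classical
  rw [initialIdeal_eq_span]
  constructor
  · intro h
    rw [mem_ideal_span_monomial_image] at h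
    obtain ⟨β, hβ, hle⟩ := h α (by simp [mem_support_iff])
    exact leadingExponents_mono_le hβ hle
  · intro h
    exact Ideal.subset_span ⟨α, h, rfl⟩

/-- An ideal containing the homogeneous components of its elements. -/
def IsHomog (J : Ideal (CoordRing K n)) : Prop :=
  ∀ f ∈ J, ∀ d, homogeneousComponent d f ∈ J

/-- The coefficients of degree `d`. -/
def degreeCoeffs (K : Type*) [Field K] (n d : ℕ) :
    CoordRing K n →ₗ[K] (DegExp n d → K) :=
  LinearMap.pi fun α => lcoeff K α.1

@[simp] theorem degreeCoeffs_apply (d : ℕ) (f : CoordRing K n)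
    (α : DegExp n d) : degreeCoeffs K n d f α = coeff α.1 f := rfl

theorem degreeCoeffs_injOn {d : ℕ} {f : CoordRing K n} (hf : f ∈ homogeneousSubmodule _ K d)
    (h : degreeCoeffs K n d f = 0) : f = 0 := by
  ext α
  by_cases hα : α.degree = d
  · exact congrFun h ⟨α, hα⟩
  · exact ((mem_homogeneousSubmodule _ _).1 hf).coeff_eq_zero hα

/-- An element may be replaced by its component of degree `d`. This turns leading exponents into
last nonzero coordinates of vectors, as in `finrank_range_eq_card_leading`. -/
theorem mem_leadingExponents_iff {J : Ideal (CoordRing K n)} (hJ : IsHomog J) {d : ℕ}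
    (α : DegExp n d) :
    α.1 ∈ leadingExponents J ↔ ∃ w :
      (J.restrictScalars K ⊓ homogeneousSubmodule _ K d : Submodule K (CoordRing K n)),
      degreeCoeffs K n d w.1 α ≠ 0 ∧ ∀ β, α < β → degreeCoeffs K n d w.1 β = 0 := by
  constructor
  · rintro ⟨f, hf, h1, h2⟩
    refine ⟨⟨homogeneousComponent d f, hJ f hf d, homogeneousComponent_mem d f⟩, ?_, ?_⟩
    · rw [degreeCoeffs_apply, coeff_homogeneousComponent, if_pos α.2]
      exact mem_support_iff.1 h1
    · intro β hβ
      rw [degreeCoeffs_apply, coeff_homogeneousComponent, if_pos β.2]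
      by_contra h0
      have h3 := h2 β.1 (mem_support_iff.2 h0) (fun h => hβ.ne (DegExp.ext h.symm))
      exact lt_asymm hβ (lt_iff_degRevLexLT.2 h3)
  · rintro ⟨⟨f, hf, hfd⟩, h1, h2⟩
    refine ⟨f, hf, mem_support_iff.2 h1, fun β hβ hne => ?_⟩
    have hd : β.degree = d := by
      by_contra h0
      exact mem_support_iff.1 hβ (((mem_homogeneousSubmodule _ _).1 hfd).coeff_eq_zero h0)
    have h3 : ¬ α < ⟨β, hd⟩ := fun h => mem_support_iff.1 hβ (h2 ⟨β, hd⟩ h)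
    have h4 : (⟨β, hd⟩ : DegExp n d) < α :=
      lt_of_le_of_ne (not_lt.1 h3) fun h => hne (congrArg DegExp.val h)
    exact lt_iff_degRevLexLT.1 h4

theorem finrank_homogeneous_part {J : Ideal (CoordRing K n)} (hJ : IsHomog J) (d : ℕ) :
    Module.finrank K (J.restrictScalars K ⊓ homogeneousSubmodule _ K d :
        Submodule K (CoordRing K n)) =
      Nat.card {α : DegExp n d // α.1 ∈ leadingExponents J} := by
  set W := (J.restrictScalars K ⊓ homogeneousSubmodule _ K d : Submodule K (CoordRing K n))
  let c : W →ₗ[K] _ := (degreeCoeffs K n d).comp W.subtype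
  have hc : Function.Injective c := by
    rw [← LinearMap.ker_eq_bot, LinearMap.ker_eq_bot']
    intro w hw
    exact Subtype.ext (degreeCoeffs_injOn w.2.2 hw)
  rw [← LinearMap.finrank_range_of_inj hc, finrank_range_eq_card_leading c]
  refine Nat.card_congr (Equiv.subtypeEquivRight fun α => ?_)
  exact (mem_leadingExponents_iff hJ α).symm

instance finite_homogeneousSubmodule (d : ℕ) :
    Module.Finite K (homogeneousSubmodule (Fin (n + 1)) K d) :=
  Module.Finite.iff_fg.2 (homogeneousSubmodule_fg _ _ d)

theorem finrank_homogeneousSubmodule (d : ℕ) :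
    Module.finrank K (homogeneousSubmodule (Fin (n + 1)) K d) =
      Nat.card (DegExp n d) := by
  have h := finrank_homogeneous_part (K := K) (n := n) (J := ⊤) (fun _ _ _ => trivial) d
  have h1 : ((⊤ : Ideal (CoordRing K n)).restrictScalars K ⊓ homogeneousSubmodule _ K d :
      Submodule K (CoordRing K n)) = homogeneousSubmodule (Fin (n + 1)) K d := by
    ext; simp
  rw [h1] at h
  rw [h]
  refine Nat.card_congr (Equiv.subtypeUnivEquiv fun α => ?_)
  exact ⟨_, trivial, isLeadingExponent_monomial α.1⟩

theorem hilbertFunction_add_finrank (J : Ideal (CoordRing K n)) (d : ℕ) :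
    hilbertFunction J d + Module.finrank K (J.restrictScalars K ⊓ homogeneousSubmodule _ K d :
        Submodule K (CoordRing K n)) =
      Nat.card (DegExp n d) := by
  rw [← finrank_homogeneousSubmodule (K := K), hilbertFunction,
    ← Submodule.finrank_quotient_add_finrank
      ((J.restrictScalars K).submoduleOf (homogeneousSubmodule (Fin (n + 1)) K d))]
  congr 1
  have := Submodule.map_comap_subtype (homogeneousSubmodule (Fin (n + 1)) K d) (J.restrictScalars K)
  rw [inf_comm, ← this]
  exact LinearEquiv.finrank_eq (Submodule.equivSubtypeMap _ _).symm

/-- Macaulay: the monomials outside the initial ideal are a basis modulo the ideal. -/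
theorem hilbertFunction_eq_card {J : Ideal (CoordRing K n)} (hJ : IsHomog J) (d : ℕ) :
    hilbertFunction J d =
      Nat.card {α : DegExp n d // α.1 ∉ leadingExponents J} := by
  classical
  have h := hilbertFunction_add_finrank J d
  rw [finrank_homogeneous_part hJ] at h
  have h2 := Nat.card_congr (Equiv.sumCompl
    fun α : DegExp n d => α.1 ∈ leadingExponents J)
  rw [Nat.card_sum] at h2
  omega

end Leading

/-! ### Linear changes of coordinates -/

section CoordChange

variable {K : Type*} [Field K] {n : ℕ}

theorem isHomogeneous_coordChange (g : GL (Fin (n + 1)) K) {d : ℕ} {f : CoordRing K n}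
    (hf : f.IsHomogeneous d) : (coordChange g f).IsHomogeneous d := by
  have h := hf.aeval (S := K) (τ := Fin (n + 1))
    (g := fun j => ∑ i, MvPolynomial.C (g.1 i j) * MvPolynomial.X i) (n := 1) fun j =>
      IsHomogeneous.sum _ _ _ fun i _ => isHomogeneous_C_mul_X _ _
  rwa [one_mul] at h

theorem coordChange_mul (g h : GL (Fin (n + 1)) K) (f : CoordRing K n) :
    coordChange (g * h) f = coordChange g (coordChange h f) := by
  suffices H : coordChange (g * h) = (coordChange g).comp (coordChange h) from
    DFunLike.congr_fun H f
  ext1 j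
  simp only [coordChange, aeval_X, AlgHom.comp_apply, map_sum, map_mul, algHom_C,
    Units.val_mul, Matrix.mul_apply, Finset.sum_mul, Finset.mul_sum]
  rw [Finset.sum_comm]
  refine Finset.sum_congr rfl fun i _ => Finset.sum_congr rfl fun k _ => ?_
  simp only [algebraMap_eq]
  ring

theorem coordChange_one (f : CoordRing K n) : coordChange (1 : GL (Fin (n + 1)) K) f = f := by
  suffices H : coordChange (1 : GL (Fin (n + 1)) K) = AlgHom.id K _ from DFunLike.congr_fun H f
  ext1 j
  simp [coordChange, Matrix.one_apply]

/-- A linear change of coordinates as an automorphism. -/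
def coordChangeEquiv (g : GL (Fin (n + 1)) K) : CoordRing K n ≃ₐ[K] CoordRing K n :=
  AlgEquiv.ofAlgHom (coordChange g) (coordChange g⁻¹)
    (AlgHom.ext fun f => by
      rw [AlgHom.comp_apply, ← coordChange_mul, mul_inv_cancel, coordChange_one]; rfl)
    (AlgHom.ext fun f => by
      rw [AlgHom.comp_apply, ← coordChange_mul, inv_mul_cancel, coordChange_one]; rfl)

theorem coordChange_inv_apply (g : GL (Fin (n + 1)) K) (f : CoordRing K n) :
    coordChange g⁻¹ (coordChange g f) = f := by
  rw [← coordChange_mul, inv_mul_cancel, coordChange_one]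

theorem coordChange_apply_inv (g : GL (Fin (n + 1)) K) (f : CoordRing K n) :
    coordChange g (coordChange g⁻¹ f) = f := by
  rw [← coordChange_mul, mul_inv_cancel, coordChange_one]

theorem mem_map_coordChange (g : GL (Fin (n + 1)) K) {J : Ideal (CoordRing K n)}
    {f : CoordRing K n} : f ∈ J.map (coordChange g) ↔ coordChange g⁻¹ f ∈ J := by
  have hs : Function.Surjective (coordChange g) := fun f => ⟨_, coordChange_apply_inv g f⟩
  rw [Ideal.mem_map_iff_of_surjective _ hs]
  constructor
  · rintro ⟨x, hx, rfl⟩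
    rwa [coordChange_inv_apply]
  · intro h
    exact ⟨_, h, coordChange_apply_inv g f⟩

theorem coordChange_mem_map (g : GL (Fin (n + 1)) K) {J : Ideal (CoordRing K n)}
    {f : CoordRing K n} : coordChange g f ∈ J.map (coordChange g) ↔ f ∈ J := by
  rw [mem_map_coordChange, coordChange_inv_apply]

theorem homogeneousComponent_coordChange (g : GL (Fin (n + 1)) K) (d : ℕ) (f : CoordRing K n) :
    homogeneousComponent d (coordChange g f) = coordChange g (homogeneousComponent d f) := by
  classical
  conv_lhs => rw [← sum_homogeneousComponent f]
  rw [map_sum, map_sum]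
  have h : ∀ i, homogeneousComponent d (coordChange g (homogeneousComponent i f)) =
      if i = d then coordChange g (homogeneousComponent d f) else 0 := by
    intro i
    rw [homogeneousComponent_of_mem (m := d) (n := i)
      (isHomogeneous_coordChange g (homogeneousComponent_isHomogeneous i f))]
    by_cases hi : i = d
    · simp [hi]
    · rw [if_neg hi, if_neg (fun h => hi h.symm)]
  simp only [h, Finset.sum_ite_eq', Finset.mem_range]
  split_ifs with hd
  · rfl
  · rw [homogeneousComponent_eq_zero _ _ (by omega), map_zero]

theorem IsHomog.map_coordChange {J : Ideal (CoordRing K n)} (hJ : IsHomog J)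
    (g : GL (Fin (n + 1)) K) : IsHomog (J.map (coordChange g)) := by
  intro f hf d
  rw [mem_map_coordChange] at hf ⊢
  rw [← homogeneousComponent_coordChange]
  exact hJ _ hf d

/-- A change of coordinates identifies the homogeneous parts of an ideal and of its image. -/
def homogeneousPartEquiv (g : GL (Fin (n + 1)) K) (J : Ideal (CoordRing K n)) (d : ℕ) :
    (J.restrictScalars K ⊓ homogeneousSubmodule _ K d : Submodule K (CoordRing K n)) ≃ₗ[K]
    ((J.map (coordChange g)).restrictScalars K ⊓ homogeneousSubmodule _ K d :
      Submodule K (CoordRing K n)) :=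
  LinearEquiv.ofSubmodules (coordChangeEquiv g).toLinearEquiv _ _ (by
    ext f
    simp only [Submodule.mem_map, Submodule.mem_inf, Submodule.restrictScalars_mem,
      mem_homogeneousSubmodule]
    constructor
    · rintro ⟨x, ⟨h1, h2⟩, rfl⟩
      exact ⟨(coordChange_mem_map g).2 h1, isHomogeneous_coordChange g h2⟩
    · rintro ⟨h1, h2⟩
      exact ⟨coordChange g⁻¹ f, ⟨(mem_map_coordChange g).1 h1, isHomogeneous_coordChange _ h2⟩,
        coordChange_apply_inv g f⟩)

theorem hilbertFunction_map_coordChange (g : GL (Fin (n + 1)) K) (J : Ideal (CoordRing K n))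
    (d : ℕ) : hilbertFunction (J.map (coordChange g)) d = hilbertFunction J d := by
  have h1 := hilbertFunction_add_finrank J d
  have h2 := hilbertFunction_add_finrank (J.map (coordChange g)) d
  have h3 := (homogeneousPartEquiv g J d).finrank_eq
  omega

/-- The substitution is carried out with a matrix of indeterminates, and the coefficient is
specialised afterwards. -/
theorem coordChange_coeff_polynomial (f : CoordRing K n) (α : Fin (n + 1) →₀ ℕ) :
    ∃ P : MvPolynomial (Fin (n + 1) × Fin (n + 1)) K, ∀ s : Fin (n + 1) × Fin (n + 1) → K,
      coeff α (aeval (fun j => ∑ i, C (s (i, j)) * (X i : CoordRing K n)) f) = eval s P := by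
  let q : MvPolynomial (Fin (n + 1)) (MvPolynomial (Fin (n + 1) × Fin (n + 1)) K) :=
    aeval (fun j => ∑ i, C (X (i, j)) * X i) f
  refine ⟨coeff α q, fun s => ?_⟩
  rw [← coeff_map]
  congr 1
  suffices H : (aeval (fun j => ∑ i, C (s (i, j)) * (X i : CoordRing K n))).toRingHom =
      (MvPolynomial.map (eval s)).comp (aeval (R := K) (S₁ := MvPolynomial (Fin (n + 1))
        (MvPolynomial (Fin (n + 1) × Fin (n + 1)) K)) fun j => ∑ i, C (X (i, j)) * X i).toRingHom
      from DFunLike.congr_fun H f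
  refine MvPolynomial.ringHom_ext (fun r => ?_) fun j => ?_
  · simp [MvPolynomial.algebraMap_apply]
  · simp

end CoordChange

/-! ### Generic rank -/

/-- The rank of a linear map depending polynomially on parameters is constant on a nonempty
Zariski open subset. -/
theorem exists_generic_rank {K W ι σ : Type*} [Field K] [AddCommGroup W] [Module K W]
    [Module.Finite K W] [Finite ι] (c : (σ → K) → W →ₗ[K] ι → K)
    (hc : ∀ w i, ∃ P : MvPolynomial σ K, ∀ s, c s w i = eval s P) :
    ∃ F : MvPolynomial σ K, F ≠ 0 ∧ ∃ ρ, ∀ s, eval s F ≠ 0 →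
      Module.finrank K (LinearMap.range (c s)) = ρ := by
  classical
  have := Fintype.ofFinite ι
  -- A parameter of maximal rank: near it, in the Zariski sense, the rank cannot drop.
  obtain ⟨s₀, hs₀⟩ : ∃ s₀, ∀ s, Module.finrank K (LinearMap.range (c s)) ≤
      Module.finrank K (LinearMap.range (c s₀)) := by
    have hfin : (Set.range fun s => Module.finrank K (LinearMap.range (c s))).Finite := by
      refine (Set.finite_Iic (Module.finrank K W)).subset ?_
      rintro _ ⟨s, rfl⟩
      exact LinearMap.finrank_range_le (c s)
    obtain ⟨_, ⟨s₀, rfl⟩, h⟩ := Set.exists_max_image _ id hfin ⟨_, 0, rfl⟩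
    exact ⟨s₀, fun s => h _ ⟨s, rfl⟩⟩
  set ρ := Module.finrank K (LinearMap.range (c s₀)) with hρ
  let b := Module.finBasis K (LinearMap.range (c s₀))
  choose w hw using fun i => (b i).2
  obtain ⟨L, hL⟩ := LinearMap.exists_leftInverse_of_injective
    ((LinearMap.range (c s₀)).subtype.comp b.equivFun.symm.toLinearMap) (by
      rw [LinearMap.ker_eq_bot]
      exact (Submodule.subtype_injective _).comp b.equivFun.symm.injective)
  choose P hP using hc
  -- Row `i` of `N` holds the coordinates under `L` of the image of `w i`. At `s₀` the matrix is the
  -- identity, and wherever its determinant is nonzero the images stay independent.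
  let N : Matrix (Fin ρ) (Fin ρ) (MvPolynomial σ K) :=
    Matrix.of fun i j => ∑ x, C (L (Pi.single x 1) j) * P (w i) x
  have hN : ∀ s, (eval s).mapMatrix N = Matrix.of fun i j => L (c s (w i)) j := by
    intro s
    ext i j
    have h1 : c s (w i) = ∑ x, c s (w i) x • (Pi.single x (1 : K) : ι → K) := by
      ext y; simp [Finset.sum_apply, Pi.single_apply]
    simp only [RingHom.mapMatrix_apply, Matrix.map_apply, N, Matrix.of_apply, map_sum, map_mul,
      eval_C, ← hP]
    conv_rhs => rw [h1]
    simp only [map_sum, map_smul, Finset.sum_apply, Pi.smul_apply, smul_eq_mul]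
    exact Finset.sum_congr rfl fun _ _ => mul_comm _ _
  have hdet : ∀ s, eval s N.det = (Matrix.of fun i j => L (c s (w i)) j).det := by
    intro s; rw [RingHom.map_det, hN]
  refine ⟨N.det, ?_, ρ, fun s hs => le_antisymm (hs₀ s) ?_⟩
  · intro h0
    have h1 := hdet s₀
    rw [h0, map_zero] at h1
    have h2 : (Matrix.of fun i j => L (c s₀ (w i)) j) = 1 := by
      ext i j
      have h3 := DFunLike.congr_fun hL (b.equivFun (b i))
      simp only [LinearMap.comp_apply, LinearEquiv.coe_coe, LinearEquiv.symm_apply_apply,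
        Submodule.subtype_apply, LinearMap.id_apply] at h3
      rw [Matrix.of_apply, hw, h3]
      simp [Matrix.one_apply]
    rw [h2, Matrix.det_one] at h1
    exact zero_ne_one h1
  · rw [hdet] at hs
    have hli := Matrix.linearIndependent_rows_of_det_ne_zero hs
    have hli2 : LinearIndependent K fun i => (⟨c s (w i), w i, rfl⟩ : LinearMap.range (c s)) :=
      LinearIndependent.of_comp (L.comp (LinearMap.range (c s)).subtype) hli
    simpa using hli2.fintype_card_le_finrank

/-! ### Existence of the generic initial ideal -/

section Gin

variable {K : Type*} [Field K] {n : ℕ}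

/-- Being leading at an exponent of `U` involves only coefficients at larger exponents, which again
lie in `U`. The count is thus the rank of the coefficient map truncated to `U`, and
`exists_generic_rank` applies. -/
theorem exists_generic_leadingExponents_card {J : Ideal (CoordRing K n)} (hJ : IsHomog J) {d : ℕ}
    (U : UpperSet (DegExp n d)) :
    ∃ F : MvPolynomial (Fin (n + 1) × Fin (n + 1)) K, F ≠ 0 ∧ ∃ ρ, ∀ g : GL (Fin (n + 1)) K,
      eval (fun ij => g.1 ij.1 ij.2) F ≠ 0 →
      Nat.card {α : DegExp n d // α ∈ U ∧ α.1 ∈ leadingExponents (J.map (coordChange g))} = ρ := by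
  classical
  let W := (J.restrictScalars K ⊓ homogeneousSubmodule _ K d : Submodule K (CoordRing K n))
  have : Module.Finite K W :=
    Submodule.finiteDimensional_of_le (inf_le_right : W ≤ homogeneousSubmodule _ K d)
  let c : (Fin (n + 1) × Fin (n + 1) → K) → W →ₗ[K] ({α : DegExp n d // α ∈ U} → K) := fun s =>
    (LinearMap.funLeft K K Subtype.val).comp ((degreeCoeffs K n d).comp
      ((aeval (fun j => ∑ i, C (s (i, j)) * (X i : CoordRing K n))).toLinearMap.comp W.subtype))
  obtain ⟨F, hF, ρ, h⟩ := exists_generic_rank c fun w i => coordChange_coeff_polynomial w.1 i.1.1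
  refine ⟨F, hF, ρ, fun g hg => ?_⟩
  rw [← h _ hg, finrank_range_eq_card_leading]
  refine Nat.card_congr ?_
  refine (Equiv.subtypeSubtypeEquivSubtypeInter _ _).symm.trans (Equiv.subtypeEquivRight ?_)
  rintro ⟨α, hα⟩
  rw [mem_leadingExponents_iff (hJ.map_coordChange g)]
  constructor
  · rintro ⟨w, h1, h2⟩
    refine ⟨(homogeneousPartEquiv g J d).symm w, ?_, ?_⟩
    · have : coordChange g ((homogeneousPartEquiv g J d).symm w).1 = w.1 :=
        congrArg Subtype.val ((homogeneousPartEquiv g J d).apply_symm_apply w)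
      rw [← this] at h1
      exact h1
    · intro j hj
      have := h2 j.1 hj
      have h3 : coordChange g ((homogeneousPartEquiv g J d).symm w).1 = w.1 :=
        congrArg Subtype.val ((homogeneousPartEquiv g J d).apply_symm_apply w)
      rw [← h3] at this
      exact this
  · rintro ⟨w, h1, h2⟩
    exact ⟨homogeneousPartEquiv g J d w, h1, fun β hβ => h2 ⟨β, U.upper hβ.le hα⟩ hβ⟩

/-- An exponent `α` is leading exactly when the numbers of leading exponents in `[α, ∞)` and in `(α,
∞)` differ, and both numbers are generically constant. -/
theorem exists_generic_leadingExponents_degree {J : Ideal (CoordRing K n)} (hJ : IsHomog J)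
    (d : ℕ) :
    ∃ F : MvPolynomial (Fin (n + 1) × Fin (n + 1)) K, F ≠ 0 ∧ ∃ A : Set (DegExp n d),
      ∀ g : GL (Fin (n + 1)) K, eval (fun ij => g.1 ij.1 ij.2) F ≠ 0 →
      ∀ α : DegExp n d, α.1 ∈ leadingExponents (J.map (coordChange g)) ↔ α ∈ A := by
  classical
  choose F hF ρ h using fun U : UpperSet (DegExp n d) => exists_generic_leadingExponents_card hJ U
  refine ⟨∏ α, (F (UpperSet.Ici α) * F (UpperSet.Ioi α)),
    Finset.prod_ne_zero_iff.2 fun α _ => mul_ne_zero (hF _) (hF _),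
    {α | ρ (UpperSet.Ici α) ≠ ρ (UpperSet.Ioi α)}, fun g hg α => ?_⟩
  rw [map_prod, Finset.prod_ne_zero_iff] at hg
  have hα := hg α (Finset.mem_univ _)
  rw [map_mul] at hα
  rw [Set.mem_ofPred_eq, ← h _ g (left_ne_zero_of_mul hα), ← h _ g (right_ne_zero_of_mul hα)]
  set E := leadingExponents (J.map (coordChange g))
  simp only [UpperSet.mem_Ici_iff, UpperSet.mem_Ioi_iff]
  rw [Nat.card_eq_fintype_card, Nat.card_eq_fintype_card, Fintype.card_subtype,
    Fintype.card_subtype]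
  by_cases hE : α.1 ∈ E
  · simp only [hE, true_iff]
    refine (Finset.card_lt_card ?_).ne'
    rw [Finset.ssubset_iff_of_subset]
    · exact ⟨α, by simp [hE], by simp⟩
    · intro x; simp only [Finset.mem_filter, Finset.mem_univ, true_and]
      exact fun h => ⟨h.1.le, h.2⟩
  · simp only [hE, false_iff, not_not]
    congr 1
    ext x
    simp only [Finset.mem_filter, Finset.mem_univ, true_and]
    refine and_congr_left fun hx => ⟨fun h => lt_of_le_of_ne h ?_, fun h => h.le⟩
    rintro rfl
    exact hE hx

theorem exists_GL_eval_ne_zero [Infinite K]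
    {F : MvPolynomial (Fin (n + 1) × Fin (n + 1)) K} (hF : F ≠ 0) :
    ∃ g : GL (Fin (n + 1)) K, eval (fun ij => g.1 ij.1 ij.2) F ≠ 0 := by
  have hne : F * (Matrix.mvPolynomialX (Fin (n + 1)) (Fin (n + 1)) K).det ≠ 0 :=
    mul_ne_zero hF (Matrix.det_mvPolynomialX_ne_zero _ _)
  obtain ⟨s, hs⟩ : ∃ s, eval s
      (F * (Matrix.mvPolynomialX (Fin (n + 1)) (Fin (n + 1)) K).det) ≠ 0 := by
    by_contra! h
    exact hne (MvPolynomial.funext fun s => by rw [h s, map_zero])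
  rw [map_mul, Matrix.eval_det_mvPolynomialX] at hs
  exact ⟨Matrix.GeneralLinearGroup.mkOfDetNeZero _ (right_ne_zero_of_mul hs),
    left_ne_zero_of_mul hs⟩

theorem card_leadingExponents_map_coordChange {J : Ideal (CoordRing K n)} (hJ : IsHomog J)
    (g : GL (Fin (n + 1)) K) (d : ℕ) :
    Nat.card {α : DegExp n d // α.1 ∈ leadingExponents (J.map (coordChange g))} =
      Nat.card {α : DegExp n d // α.1 ∈ leadingExponents J} := by
  rw [← finrank_homogeneous_part hJ, ← finrank_homogeneous_part (hJ.map_coordChange g)]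
  exact (homogeneousPartEquiv g J d).finrank_eq.symm

/-- Each degree has its own open set, and infinitely many need not meet. Finitely many degrees
suffice: they put generators of the candidate ideal into the initial ideal, and equality follows
because the number of leading exponents in each degree does not depend on `g`. -/
theorem exists_isGenericInitialIdeal [Infinite K] {J : Ideal (CoordRing K n)} (hJ : IsHomog J) :
    ∃ M, IsGenericInitialIdeal J M := by
  classical
  choose F hF A hA using exists_generic_leadingExponents_degree hJ
  let B : Set (Fin (n + 1) →₀ ℕ) := {α | (⟨α, rfl⟩ : DegExp n α.degree) ∈ A α.degree}
  have hB : ∀ {d} (α : DegExp n d), α.1 ∈ B ↔ α ∈ A d := by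
    rintro d ⟨α, rfl⟩; exact Iff.rfl
  obtain ⟨T', hT', hspan⟩ := Submodule.fg_span_iff_fg_span_finset_subset _ |>.1
    (IsNoetherian.noetherian (Ideal.span ((fun α => monomial α (1 : K)) '' B)))
  obtain ⟨T, hTB, hT⟩ := Set.subset_image_iff.1 hT'
  have hTfin : T.Finite := by
    refine Set.Finite.of_finite_image (f := fun α => monomial α (1 : K)) ?_ ?_
    · rw [hT]; exact T'.finite_toSet
    · exact (monomial_left_injective one_ne_zero).injOn
  refine ⟨Ideal.span ((fun α => monomial α (1 : K)) '' B), ∏ α ∈ hTfin.toFinset, F α.degree,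
    Finset.prod_ne_zero_iff.2 fun α _ => hF _,
    fun g hg => ?_⟩
  rw [map_prod, Finset.prod_ne_zero_iff] at hg
  have hTE : T ⊆ leadingExponents (J.map (coordChange g)) := fun α hα =>
    (hA _ g (hg α (hTfin.mem_toFinset.2 hα)) ⟨α, rfl⟩).2 (hTB hα)
  have hle : Ideal.span ((fun α => monomial α (1 : K)) '' B) ≤
      initialIdeal (J.map (coordChange g)) := by
    rw [initialIdeal_eq_span]
    refine hspan.le.trans ?_
    rw [← hT]
    exact Ideal.span_mono (Set.image_mono hTE)
  have hBE : B ⊆ leadingExponents (J.map (coordChange g)) := fun α hα =>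
    monomial_mem_initialIdeal_iff.1 (hle (Ideal.subset_span ⟨α, hα, rfl⟩))
  have hEB : leadingExponents (J.map (coordChange g)) = B := by
    refine Set.Subset.antisymm (fun α hα => ?_) hBE
    -- An auxiliary `g'`, generic for this degree only, shows that `B` has the right number of
    -- exponents there.
    obtain ⟨g', hg'⟩ := exists_GL_eval_ne_zero (hF α.degree)
    have h1 := card_leadingExponents_map_coordChange hJ g α.degree
    rw [← card_leadingExponents_map_coordChange hJ g' α.degree] at h1
    have h2 : (Finset.univ.filter fun β : DegExp n α.degree => β ∈ A α.degree) =
        Finset.univ.filter fun β : DegExp n α.degree =>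
          β.1 ∈ leadingExponents (J.map (coordChange g)) := by
      refine Finset.eq_of_subset_of_card_le (fun β hβ => ?_) ?_
      · simp only [Finset.mem_filter, Finset.mem_univ, true_and] at hβ ⊢
        exact hBE ((hB β).2 hβ)
      · rw [← Fintype.card_subtype, ← Fintype.card_subtype, ← Nat.card_eq_fintype_card,
          ← Nat.card_eq_fintype_card, h1]
        exact (Nat.card_congr (Equiv.subtypeEquivRight fun β => hA _ g' hg' β)).le
    have h3 : (⟨α, rfl⟩ : DegExp n α.degree) ∈ Finset.univ.filter fun β : DegExp n α.degree =>
        β.1 ∈ leadingExponents (J.map (coordChange g)) := by simpa using hα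
    rw [← h2, Finset.mem_filter] at h3
    exact h3.2
  rw [initialIdeal_eq_span, hEB]

theorem gin_spec [Infinite K] {J : Ideal (CoordRing K n)} (hJ : IsHomog J) :
    IsGenericInitialIdeal J (gin J) := by
  have h := exists_isGenericInitialIdeal hJ
  rw [gin, dif_pos h]
  exact h.choose_spec

end Gin

/-! ### Symbolic powers of finite intersections of primes -/

section Symbolic

variable {R : Type*} [CommRing R]

theorem mem_comap_map_localization {Q I : Ideal R} [Q.IsPrime] {f : R} :
    f ∈ (I.map (algebraMap R (Localization.AtPrime Q))).comap
      (algebraMap R (Localization.AtPrime Q)) ↔ ∃ s, s ∉ Q ∧ s * f ∈ I := by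
  rw [Ideal.mem_comap, IsLocalization.algebraMap_mem_map_algebraMap_iff Q.primeCompl]
  rfl

theorem exists_notMem_of_incomparable {ι : Type*} [Finite ι] {p : ι → Ideal R}
    (hp : ∀ i, (p i).IsPrime) (hinc : ∀ i j, p i ≤ p j → i = j) (i : ι) :
    ∃ x, x ∉ p i ∧ ∀ j, j ≠ i → x ∈ p j := by
  classical
  have := Fintype.ofFinite ι
  have h : ∀ j : ι, ∃ x, x ∉ p i ∧ (j ≠ i → x ∈ p j) := by
    intro j
    by_cases hj : j = i
    · exact ⟨1, (Ideal.ne_top_iff_one _).1 (hp i).ne_top, fun h => absurd hj h⟩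
    · obtain ⟨x, hx, hxi⟩ := Set.not_subset.1 fun h => hj (hinc j i h)
      exact ⟨x, hxi, fun _ => hx⟩
  choose x hx1 hx2 using h
  have := hp i
  refine ⟨∏ j, x j, fun h => ?_, fun j hj => ?_⟩
  · obtain ⟨j, -, hj⟩ := (Ideal.IsPrime.prod_mem_iff).1 h
    exact hx1 j hj
  · exact Ideal.mem_of_dvd _ (Finset.dvd_prod_of_mem x (Finset.mem_univ j)) (hx2 j hj)

/-- The annihilator of the class of `x` is the intersection of the `p i` not containing `x`. If it
is prime it is one of them. Conversely, an `x` lying in all the primes but `p i` has annihilator `p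
i`. -/
theorem associatedPrimes_quotient_iInf [IsNoetherianRing R] {ι : Type*} [Finite ι]
    {p : ι → Ideal R} (hp : ∀ i, (p i).IsPrime) (hinc : ∀ i j, p i ≤ p j → i = j) :
    associatedPrimes R (R ⧸ ⨅ i, p i) = Set.range p := by
  classical
  have := Fintype.ofFinite ι
  ext Q
  rw [AssociatedPrimes.mem_iff, isAssociatedPrime_iff]
  constructor
  · rintro ⟨hQ, x, rfl⟩
    obtain ⟨x, rfl⟩ := Ideal.Quotient.mk_surjective x
    have hmem : ∀ r, r ∈ Submodule.colon (⊥ : Submodule R (R ⧸ ⨅ i, p i))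
        {Ideal.Quotient.mk _ x} ↔ ∀ i, r * x ∈ p i := by
      intro r
      rw [Submodule.mem_colon_singleton, Submodule.mem_bot, ← Submodule.mem_iInf,
        ← Ideal.Quotient.eq_zero_iff_mem]
      rfl
    have hinf : (Finset.univ.filter fun i => x ∉ p i).inf p ≤
        Submodule.colon (⊥ : Submodule R (R ⧸ ⨅ i, p i)) {Ideal.Quotient.mk _ x} := by
      intro r hr
      rw [hmem]
      intro i
      by_cases hx : x ∈ p i
      · exact (p i).mul_mem_left _ hx
      · rw [Submodule.mem_finsetInf] at hr
        exact (p i).mul_mem_right _ (hr i (by simpa using hx))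
    obtain ⟨i, hi, hle⟩ := (Ideal.IsPrime.inf_le' hQ).1 hinf
    refine ⟨i, le_antisymm hle fun r hr => ?_⟩
    have := hp i
    exact ((hp i).mem_or_mem ((hmem r).1 hr i)).resolve_right (by simpa using hi)
  · rintro ⟨i, rfl⟩
    refine ⟨hp i, ?_⟩
    obtain ⟨x, hx1, hx2⟩ := exists_notMem_of_incomparable hp hinc i
    refine ⟨Ideal.Quotient.mk _ x, ?_⟩
    ext r
    have : r ∈ Submodule.colon (⊥ : Submodule R (R ⧸ ⨅ i, p i)) {Ideal.Quotient.mk _ x} ↔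
        ∀ i, r * x ∈ p i := by
      rw [Submodule.mem_colon_singleton, Submodule.mem_bot, ← Submodule.mem_iInf,
        ← Ideal.Quotient.eq_zero_iff_mem]
      rfl
    rw [this]
    constructor
    · intro hr j
      by_cases hj : j = i
      · subst hj; exact (p j).mul_mem_right _ hr
      · exact (p j).mul_mem_left _ (hx2 j hj)
    · intro h
      exact ((hp i).mem_or_mem (h i)).resolve_right hx1

/-- The symbolic power of a finite intersection of incomparable primes with primary powers. -/
theorem symbolicPower_iInf [IsNoetherianRing R] {ι : Type*} [Finite ι]
    {p : ι → Ideal R} (hp : ∀ i, (p i).IsPrime) (hinc : ∀ i j, p i ≤ p j → i = j)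
    (m : ℕ) (hprim : ∀ i s f, s ∉ p i → s * f ∈ p i ^ m → f ∈ p i ^ m) :
    symbolicPower (⨅ i, p i) m = ⨅ i, p i ^ m := by
  have hcomap : ∀ i f, (∃ s, s ∉ p i ∧ s * f ∈ (⨅ i, p i) ^ m) ↔ f ∈ p i ^ m := by
    intro i f
    constructor
    · rintro ⟨s, hs, hsf⟩
      exact hprim i s f hs (Ideal.pow_right_mono (iInf_le p i) m hsf)
    · intro hf
      obtain ⟨x, hx1, hx2⟩ := exists_notMem_of_incomparable hp hinc i
      -- Since `x * p i` lies in the intersection of all the primes, `x ^ m * p i ^ m` lies in its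
      -- `m`-th power.
      refine ⟨x ^ m, fun h => hx1 ((hp i).mem_of_pow_mem m h), ?_⟩
      have h1 : Ideal.span {x} * p i ≤ ⨅ i, p i := by
        refine le_iInf fun j => ?_
        by_cases hj : j = i
        · subst hj; exact Ideal.mul_le_right
        · exact Ideal.mul_le_left.trans ((Ideal.span_singleton_le_iff_mem _).2 (hx2 j hj))
      have h2 := Ideal.pow_right_mono h1 m
      rw [mul_pow, Ideal.span_singleton_pow] at h2
      exact h2 (Ideal.mul_mem_mul (Ideal.mem_span_singleton_self _) hf)
  ext f
  simp only [symbolicPower, Submodule.mem_iInf]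
  constructor
  · intro h i
    have hi : p i ∈ associatedPrimes R (R ⧸ ⨅ i, p i) := by
      rw [associatedPrimes_quotient_iInf hp hinc]; exact ⟨i, rfl⟩
    have := hp i
    exact (hcomap i f).1 (mem_comap_map_localization.1 (h (p i) hi))
  · intro h Q hQ
    have hQ' := hQ
    rw [associatedPrimes_quotient_iInf hp hinc] at hQ'
    obtain ⟨i, rfl⟩ := hQ'
    have := hp i
    exact mem_comap_map_localization.2 ((hcomap i f).2 (h i))

end Symbolic

/-! ### The ideal of a point -/

section Point

variable {K : Type*} [Field K] {n : ℕ}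

/-- Restriction of polynomials to the line through a vector. -/
def lineEval (v : Fin (n + 1) → K) : CoordRing K n →ₐ[K] Polynomial K :=
  aeval fun j => Polynomial.C (v j) * Polynomial.X

/-- The prime ideal of the line through a vector. -/
def pointIdeal (v : Fin (n + 1) → K) : Ideal (CoordRing K n) := RingHom.ker (lineEval v)

theorem mem_pointIdeal {v : Fin (n + 1) → K} {f : CoordRing K n} :
    f ∈ pointIdeal v ↔ lineEval v f = 0 := Iff.rfl

instance pointIdeal_isPrime (v : Fin (n + 1) → K) : (pointIdeal v).IsPrime :=
  RingHom.ker_isPrime _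

theorem lineEval_of_isHomogeneous (v : Fin (n + 1) → K) {d : ℕ} {f : CoordRing K n}
    (hf : f.IsHomogeneous d) : lineEval v f = Polynomial.C (eval v f) * Polynomial.X ^ d := by
  rw [lineEval, aeval_def, eval₂_eq, eval_eq, map_sum, Finset.sum_mul]
  refine Finset.sum_congr rfl fun α hα => ?_
  rw [map_mul, map_prod]
  simp only [mul_pow, Finset.prod_mul_distrib, Finset.prod_pow_eq_pow_sum, map_pow,
    ← hf.degree_eq_sum_deg_support hα]
  rw [mul_assoc]
  rfl

theorem mem_pointIdeal_of_isHomogeneous {v : Fin (n + 1) → K} {d : ℕ} {f : CoordRing K n}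
    (hf : f.IsHomogeneous d) : f ∈ pointIdeal v ↔ eval v f = 0 := by
  rw [mem_pointIdeal, lineEval_of_isHomogeneous v hf]
  simp

theorem isHomog_pointIdeal (v : Fin (n + 1) → K) : IsHomog (pointIdeal v) := by
  intro f hf d
  rw [mem_pointIdeal_of_isHomogeneous (homogeneousComponent_isHomogeneous d f)]
  rw [mem_pointIdeal, ← sum_homogeneousComponent f, map_sum] at hf
  have h := congrArg (fun q => Polynomial.coeff q d) hf
  simp only [lineEval_of_isHomogeneous v (homogeneousComponent_isHomogeneous _ f),
    Polynomial.finsetSum_coeff, Polynomial.coeff_C_mul_X_pow, Polynomial.coeff_zero,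
    Finset.sum_ite_eq, Finset.mem_range] at h
  by_cases hd : d < f.totalDegree + 1
  · rwa [if_pos hd] at h
  · rw [homogeneousComponent_eq_zero _ _ (by omega), map_zero]

theorem isHomog_iInf {ι : Sort*} {J : ι → Ideal (CoordRing K n)} (h : ∀ i, IsHomog (J i)) :
    IsHomog (⨅ i, J i) := by
  intro f hf d
  rw [Submodule.mem_iInf] at hf ⊢
  exact fun i => h i f (hf i) d

theorem isHomog_pow {J : Ideal (CoordRing K n)} (h : IsHomog J) (m : ℕ) : IsHomog (J ^ m) := by
  let : GradedAlgebra (homogeneousSubmodule (Fin (n + 1)) K) := MvPolynomial.gradedAlgebra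
  have hdec : ∀ (f : CoordRing K n) (d : ℕ),
      (DirectSum.decompose (homogeneousSubmodule (Fin (n + 1)) K) f d : CoordRing K n) =
        homogeneousComponent d f := fun f d => decomposition.decompose'_apply f d
  have hpow : (J ^ m).IsHomogeneous (homogeneousSubmodule (Fin (n + 1)) K) := by
    induction m with
    | zero => intro d f _; simp
    | succ m ih =>
      rw [pow_succ]
      refine ih.mul fun d f hf => ?_
      rw [hdec]
      exact h f hf d
  exact fun f hf d => homogeneousComponent_mem_of_mem hpow hf d

/-- A form vanishes at a point exactly when it vanishes on the line through its representative, and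
the line ideals are homogeneous. -/
theorem pointsIdeal_eq_iInf (S : Finset (ℙ K (Fin (n + 1) → K))) :
    pointsIdeal S = ⨅ p : S, pointIdeal p.1.rep := by
  apply le_antisymm
  · rw [pointsIdeal, Ideal.span_le]
    rintro f ⟨d, hf, h⟩
    rw [SetLike.mem_coe, Submodule.mem_iInf]
    exact fun p => (mem_pointIdeal_of_isHomogeneous hf).2 (h p.1 p.2)
  · intro f hf
    rw [← sum_homogeneousComponent f]
    refine Ideal.sum_mem _ fun d _ => Ideal.subset_span ⟨d, homogeneousComponent_isHomogeneous d f,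
      fun p hp => ?_⟩
    rw [← mem_pointIdeal_of_isHomogeneous (homogeneousComponent_isHomogeneous d f)]
    rw [Submodule.mem_iInf] at hf
    exact isHomog_pointIdeal _ f (hf ⟨p, hp⟩) d

/-- The linear form with the given coefficients. -/
def linForm (c : Fin (n + 1) → K) : CoordRing K n := ∑ j, C (c j) * X j

theorem isHomogeneous_linForm (c : Fin (n + 1) → K) : (linForm c).IsHomogeneous 1 :=
  IsHomogeneous.sum _ _ _ fun _ _ => isHomogeneous_C_mul_X _ _

@[simp] theorem eval_linForm (c v : Fin (n + 1) → K) : eval v (linForm c) = ∑ j, c j * v j := by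
  simp [linForm]

/-- The homomorphism scaling by `T` the directions transverse to the line through `v`, with respect
to the complement given by `linForm c = 0`. -/
def transverseScale (v c : Fin (n + 1) → K) : CoordRing K n →ₐ[K] Polynomial (CoordRing K n) :=
  aeval fun j => Polynomial.C (C (v j) * linForm c) +
    Polynomial.C (X j - C (v j) * linForm c) * Polynomial.X

theorem X_sub_mem_pointIdeal {v c : Fin (n + 1) → K} (h : ∑ j, c j * v j = 1) (j : Fin (n + 1)) :
    (X j - C (v j) * linForm c : CoordRing K n) ∈ pointIdeal v := by
  have h1 : (X j - C (v j) * linForm c : CoordRing K n).IsHomogeneous 1 :=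
    (isHomogeneous_X _ _).sub ((isHomogeneous_linForm c).C_mul _)
  rw [mem_pointIdeal_of_isHomogeneous h1]
  simp [h]

/-- The generators scaled by `T` lie in the ideal of the line, so the coefficient of `T ^ k` lies in
its `k`-th power. -/
theorem transverseScale_mem_reesAlgebra {v c : Fin (n + 1) → K} (h : ∑ j, c j * v j = 1)
    (f : CoordRing K n) : transverseScale v c f ∈ reesAlgebra (pointIdeal v) := by
  induction f using MvPolynomial.induction_on with
  | C a =>
    rw [algHom_C]
    exact (reesAlgebra (pointIdeal v)).algebraMap_mem (C a)
  | add p q hp hq => rw [map_add]; exact add_mem hp hq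
  | mul_X p j hp =>
    rw [map_mul]
    refine mul_mem hp ?_
    rw [transverseScale, aeval_X]
    refine add_mem ((reesAlgebra (pointIdeal v)).algebraMap_mem _) ?_
    rw [← pow_one Polynomial.X, Polynomial.C_mul_X_pow_eq_monomial, reesAlgebra.monomial_mem,
      pow_one]
    exact X_sub_mem_pointIdeal h j

theorem eval_one_transverseScale (v c : Fin (n + 1) → K) (f : CoordRing K n) :
    Polynomial.eval 1 (transverseScale v c f) = f := by
  induction f using MvPolynomial.induction_on with
  | C a => rw [algHom_C]; exact Polynomial.eval_C
  | add p q hp hq => rw [map_add, Polynomial.eval_add, hp, hq]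
  | mul_X p j hp => rw [map_mul, Polynomial.eval_mul, hp]; simp [transverseScale]

theorem X_dvd_transverseScale {v : Fin (n + 1) → K} (c : Fin (n + 1) → K) {f : CoordRing K n}
    (hf : f ∈ pointIdeal v) : Polynomial.X ∣ transverseScale v c f := by
  rw [Polynomial.X_dvd_iff]
  have H : ∀ f, (transverseScale v c f).coeff 0 = Polynomial.aeval (linForm c) (lineEval v f) := by
    intro f
    induction f using MvPolynomial.induction_on with
    | C a =>
      rw [algHom_C, algHom_C, Polynomial.algebraMap_eq, Polynomial.aeval_C]
      exact Polynomial.coeff_C_zero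
    | add p q hp hq => rw [map_add, Polynomial.coeff_add, hp, hq, map_add, map_add]
    | mul_X p j hp =>
      rw [map_mul, Polynomial.mul_coeff_zero, hp, map_mul, map_mul]
      simp [transverseScale, lineEval]
  rw [H, mem_pointIdeal.1 hf, map_zero]

/-- Membership in a power is an order of vanishing in `T`. At `T = 0` the scaling is restriction to
the line, which kills the ideal. At `T = 1` it is the identity, so `f` is the sum of its
coefficients, each in the matching power. -/
theorem mem_pointIdeal_pow_iff {v c : Fin (n + 1) → K} (h : ∑ j, c j * v j = 1) (m : ℕ)
    {f : CoordRing K n} : f ∈ pointIdeal v ^ m ↔ Polynomial.X ^ m ∣ transverseScale v c f := by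
  constructor
  · intro hf
    have h1 : pointIdeal v ≤ (Ideal.span {(Polynomial.X : Polynomial (CoordRing K n))}).comap
        (transverseScale v c) := fun g hg =>
      Ideal.mem_span_singleton.2 (X_dvd_transverseScale c hg)
    have h2 := (Ideal.pow_right_mono h1 m).trans (Ideal.le_comap_pow _ m)
    rw [Ideal.span_singleton_pow] at h2
    exact Ideal.mem_span_singleton.1 (h2 hf)
  · intro hf
    rw [Polynomial.X_pow_dvd_iff] at hf
    rw [← eval_one_transverseScale v c f, Polynomial.eval_eq_sum_range]
    refine Ideal.sum_mem _ fun k _ => ?_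
    rw [one_pow, mul_one]
    by_cases hk : k < m
    · rw [hf k hk]; exact zero_mem _
    · exact Ideal.pow_le_pow_right (not_lt.1 hk)
        ((mem_reesAlgebra_iff _ _).1 (transverseScale_mem_reesAlgebra h f) k)

theorem exists_dual {v : Fin (n + 1) → K} (hv : v ≠ 0) :
    ∃ c : Fin (n + 1) → K, ∑ j, c j * v j = 1 := by
  obtain ⟨i, hi⟩ := Function.ne_iff.1 hv
  refine ⟨Pi.single i (v i)⁻¹, ?_⟩
  rw [Finset.sum_eq_single i]
  · simpa using inv_mul_cancel₀ hi
  · intro j _ hj; simp [hj]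
  · simp

/-- The powers of the ideal of a point are primary. -/
theorem mem_pow_of_mul_mem_pow {v : Fin (n + 1) → K} (hv : v ≠ 0) (m : ℕ) {s f : CoordRing K n}
    (hs : s ∉ pointIdeal v) (hsf : s * f ∈ pointIdeal v ^ m) : f ∈ pointIdeal v ^ m := by
  obtain ⟨c, hc⟩ := exists_dual hv
  rw [mem_pointIdeal_pow_iff hc] at *
  rw [← pow_one (pointIdeal v), mem_pointIdeal_pow_iff hc, pow_one] at hs
  rw [map_mul] at hsf
  -- Primariness reduces to `T` being a prime element that does not divide the image of `s`.
  exact Polynomial.prime_X.pow_dvd_of_dvd_mul_left m hs hsf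

end Point

/-! ### Hilbert functions of powers of the ideal of a point -/

section PointPower

variable {K : Type*} [Field K] {n : ℕ}

theorem exists_GL_last_row {v : Fin (n + 1) → K} (hv : v ≠ 0) :
    ∃ g : GL (Fin (n + 1)) K, ∀ j, g.1 (Fin.last n) j = v j := by
  classical
  obtain ⟨i₀, hi₀⟩ := Function.ne_iff.1 hv
  -- The other rows are the standard basis vectors except the one at `i₀`, where `v` is nonzero.
  let M : Matrix (Fin (n + 1)) (Fin (n + 1)) K := Matrix.of fun i =>
    if i = Fin.last n then v else Pi.single (Equiv.swap i₀ (Fin.last n) i) 1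
  have hdet : M.det ≠ 0 := by
    intro h0
    obtain ⟨x, hx, hMx⟩ := Matrix.exists_mulVec_eq_zero_iff.2 h0
    have h1 : ∀ k, k ≠ i₀ → x k = 0 := by
      intro k hk
      have h2 := congrFun hMx (Equiv.swap i₀ (Fin.last n) k)
      have h3 : Equiv.swap i₀ (Fin.last n) k ≠ Fin.last n := by
        intro h
        rw [Equiv.swap_apply_eq_iff, Equiv.swap_apply_right] at h
        exact hk h
      simpa [M, Matrix.mulVec, h3] using h2
    have h2 := congrFun hMx (Fin.last n)
    have h3 : v i₀ * x i₀ = 0 := by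
      simp only [M, Matrix.mulVec, Matrix.of_apply, if_true, dotProduct, Pi.zero_apply] at h2
      rwa [Finset.sum_eq_single i₀ (fun k _ hk => by rw [h1 k hk, mul_zero]) (by simp)] at h2
    apply hx
    ext k
    by_cases hk : k = i₀
    · subst hk; exact (mul_eq_zero.1 h3).resolve_left hi₀
    · exact h1 k hk
  exact ⟨Matrix.GeneralLinearGroup.mkOfDetNeZero M hdet, fun j => by
    simp [Matrix.GeneralLinearGroup.mkOfDetNeZero, M]⟩

theorem lineEval_coordChange (g : GL (Fin (n + 1)) K) (w : Fin (n + 1) → K) (f : CoordRing K n) :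
    lineEval w (coordChange g f) = lineEval (fun j => ∑ i, g.1 i j * w i) f := by
  suffices H : (lineEval w).comp (coordChange g) = lineEval (fun j => ∑ i, g.1 i j * w i) from
    DFunLike.congr_fun H f
  ext1 j
  simp only [lineEval, coordChange, AlgHom.comp_apply, aeval_X, map_sum, map_mul, algHom_C,
    Finset.sum_mul, Polynomial.algebraMap_eq]
  exact Finset.sum_congr rfl fun i _ => (mul_assoc _ _ _).symm

/-- The total degree of a monomial in all variables but the last. -/
def initDegree (α : Fin (n + 1) →₀ ℕ) : ℕ := ∑ i : Fin n, α i.castSucc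

theorem degree_eq_initDegree_add (α : Fin (n + 1) →₀ ℕ) :
    α.degree = initDegree α + α (Fin.last n) := by
  rw [Finsupp.degree_eq_sum, Fin.sum_univ_castSucc, initDegree]

theorem transverseScale_last_monomial (α : Fin (n + 1) →₀ ℕ) (a : K) :
    transverseScale (Pi.single (Fin.last n) 1) (Pi.single (Fin.last n) 1) (monomial α a) =
      Polynomial.C (monomial α a) * Polynomial.X ^ initDegree α := by
  have hl : linForm (Pi.single (Fin.last n) (1 : K)) = X (Fin.last n) := by
    rw [linForm, Finset.sum_eq_single (Fin.last n)]
    · simp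
    · intro j _ hj; simp [hj]
    · simp
  rw [monomial_eq, map_mul, algHom_C, Finsupp.prod_fintype _ _ (fun _ => pow_zero _), map_prod,
    Fin.prod_univ_castSucc, Fin.prod_univ_castSucc]
  simp only [map_pow, transverseScale, aeval_X, hl, initDegree, map_mul, map_prod]
  have h1 : ∀ i : Fin n, (Pi.single (Fin.last n) 1 : Fin (n + 1) → K) i.castSucc = 0 := fun i => by
    simp [Fin.castSucc_ne_last]
  simp only [h1, Pi.single_eq_same, map_zero, map_one, zero_mul, one_mul, sub_zero, sub_self,
    add_zero, zero_add, mul_pow, Finset.prod_mul_distrib, Finset.prod_pow_eq_pow_sum]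
  have h2 : (algebraMap K (Polynomial (CoordRing K n))) a = Polynomial.C (C a) := rfl
  rw [h2]
  ring

/-- At the last coordinate point the transverse scaling multiplies each monomial by `T ^
initDegree`, so the powers are monomial ideals. -/
theorem mem_pointIdeal_last_pow_iff (m : ℕ) {f : CoordRing K n} :
    f ∈ pointIdeal (Pi.single (Fin.last n) (1 : K)) ^ m ↔ ∀ α ∈ f.support, m ≤ initDegree α := by
  have hc : ∑ j, (Pi.single (Fin.last n) (1 : K) : Fin (n + 1) → K) j *
      (Pi.single (Fin.last n) (1 : K) : Fin (n + 1) → K) j = 1 := by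
    rw [Finset.sum_eq_single (Fin.last n)]
    · simp
    · intro j _ hj; simp [hj]
    · simp
  have key : ∀ (f : CoordRing K n) (k : ℕ) (α : Fin (n + 1) →₀ ℕ),
      coeff α ((transverseScale (Pi.single (Fin.last n) 1) (Pi.single (Fin.last n) 1) f).coeff k) =
        if initDegree α = k then coeff α f else 0 := by
    intro f k α
    induction f using MvPolynomial.induction_on' with
    | monomial u a =>
      classical
      rw [transverseScale_last_monomial, Polynomial.coeff_C_mul_X_pow]
      by_cases h : u = α
      · subst h
        by_cases h2 : k = initDegree u
        · simp [h2]
        · rw [if_neg h2, if_neg (fun h => h2 h.symm), coeff_zero]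
      · rw [coeff_monomial, if_neg h, ite_self]
        split_ifs
        · rw [coeff_monomial, if_neg h]
        · rw [coeff_zero]
    | add p q hp hq =>
      rw [map_add, Polynomial.coeff_add, coeff_add, hp, hq, coeff_add]
      split_ifs <;> simp
  rw [mem_pointIdeal_pow_iff hc, Polynomial.X_pow_dvd_iff]
  constructor
  · intro h α hα
    by_contra hlt
    have h1 := key f (initDegree α) α
    rw [h _ (not_le.1 hlt), if_pos rfl, coeff_zero] at h1
    exact mem_support_iff.1 hα h1.symm
  · intro h k hk
    ext α
    rw [key, coeff_zero]
    split_ifs with hα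
    · by_contra h0
      have := h α (mem_support_iff.2 h0)
      omega
    · rfl

theorem leadingExponents_pointIdeal_last_pow (m : ℕ) :
    leadingExponents (pointIdeal (Pi.single (Fin.last n) (1 : K)) ^ m) = {α | m ≤ initDegree α} := by
  classical
  ext α
  constructor
  · rintro ⟨f, hf, h1, h2⟩
    exact (mem_pointIdeal_last_pow_iff m).1 hf α h1
  · intro h
    refine ⟨monomial α 1, (mem_pointIdeal_last_pow_iff m).2 fun β hβ => ?_,
      isLeadingExponent_monomial α⟩
    simp only [mem_support_iff, coeff_monomial, ne_eq, ite_eq_right_iff, not_forall] at hβ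
    exact hβ.1 ▸ h

/-- Multiplication by the power `t - k` of the last variable is a bijection from all exponents of
degree `k`. -/
theorem card_initDegree_le {k t : ℕ} (h : k ≤ t) :
    Nat.card {α : DegExp n t // initDegree α.1 ≤ k} = (n + k).choose n := by
  rw [← card_degExp]
  have hadd : ∀ β : Fin (n + 1) →₀ ℕ, ∀ c,
      initDegree (β + Finsupp.single (Fin.last n) c) = initDegree β := by
    intro β c
    simp [initDegree]
  refine Nat.card_congr (Equiv.ofBijective (fun β : DegExp n k =>
    (⟨⟨β.1 + Finsupp.single (Fin.last n) (t - k), ?_⟩, ?_⟩ :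
      {α : DegExp n t // initDegree α.1 ≤ k})) ⟨?_, ?_⟩).symm
  · rw [map_add, β.2, Finsupp.degree_single]; omega
  · rw [hadd]
    have := degree_eq_initDegree_add β.1
    have := β.2
    omega
  · intro β γ h
    have h1 := congrArg (fun x => x.1.1) h
    exact DegExp.ext (add_right_cancel h1)
  · rintro ⟨⟨α, hα⟩, hk⟩
    have h1 := degree_eq_initDegree_add α
    have hle : Finsupp.single (Fin.last n) (t - k) ≤ α := by
      rw [Finsupp.single_le_iff]
      simp only at hk
      omega
    refine ⟨⟨α - Finsupp.single (Fin.last n) (t - k), ?_⟩, ?_⟩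
    · have h2 := congrArg Finsupp.degree (tsub_add_cancel_of_le hle)
      rw [map_add, Finsupp.degree_single] at h2
      omega
    · ext1
      exact DegExp.ext (tsub_add_cancel_of_le hle)

theorem hilbertFunction_pointIdeal_pow {v : Fin (n + 1) → K} (hv : v ≠ 0) {k t : ℕ} (h : k ≤ t) :
    hilbertFunction (pointIdeal v ^ (k + 1)) t = (n + k).choose n := by
  obtain ⟨g, hg⟩ := exists_GL_last_row hv
  have hmap : (pointIdeal v).map (coordChange g) =
      pointIdeal (Pi.single (Fin.last n) (1 : K)) := by
    ext f
    obtain ⟨f, rfl⟩ : ∃ f', coordChange g f' = f := ⟨_, coordChange_apply_inv g f⟩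
    rw [coordChange_mem_map, mem_pointIdeal, mem_pointIdeal, lineEval_coordChange]
    have : (fun j => ∑ i, g.1 i j * (Pi.single (Fin.last n) (1 : K) : Fin (n + 1) → K) i) = v := by
      ext j
      rw [Finset.sum_eq_single (Fin.last n)]
      · simp [hg]
      · intro i _ hi; simp [hi]
      · simp
    rw [this]
  rw [← hilbertFunction_map_coordChange g, Ideal.map_pow, hmap,
    hilbertFunction_eq_card (isHomog_pow (isHomog_pointIdeal _) _),
    leadingExponents_pointIdeal_last_pow, ← card_initDegree_le h]
  refine Nat.card_congr (Equiv.subtypeEquivRight fun α => ?_)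
  rw [Set.mem_ofPred_eq, not_le, Nat.lt_succ_iff]

end PointPower

/-! ### Hilbert functions of intersections -/

section Intersection

variable {K : Type*} [Field K] {n : ℕ}

/-- Chinese remainder argument: the hypothesis says that the map to the product of the quotients
hits each factor. -/
theorem finrank_quotient_iInf {ι V : Type*} [Fintype ι] [AddCommGroup V] [Module K V]
    [Module.Finite K V] {A : ι → Submodule K V}
    (h : ∀ i f, ∃ F, F - f ∈ A i ∧ ∀ j, j ≠ i → F ∈ A j) :
    Module.finrank K (V ⧸ ⨅ i, A i) = ∑ i, Module.finrank K (V ⧸ A i) := by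
  classical
  let Ψ : V →ₗ[K] Π i, V ⧸ A i := LinearMap.pi fun i => (A i).mkQ
  have hker : LinearMap.ker Ψ = ⨅ i, A i := by
    ext x
    rw [LinearMap.mem_ker, funext_iff]
    simp only [Ψ, LinearMap.pi_apply, Submodule.mkQ_apply, Pi.zero_apply,
      Submodule.Quotient.mk_eq_zero, Submodule.mem_iInf]
  have hsurj : LinearMap.range Ψ = ⊤ := by
    rw [eq_top_iff, ← LinearMap.iSup_range_single K (fun i => V ⧸ A i)]
    refine iSup_le fun i => ?_
    rintro _ ⟨y, rfl⟩
    obtain ⟨f, rfl⟩ := Submodule.mkQ_surjective _ y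
    obtain ⟨F, h1, h2⟩ := h i f
    refine ⟨F, ?_⟩
    ext j
    by_cases hj : j = i
    · subst hj
      simp only [Ψ, LinearMap.pi_apply, LinearMap.single_apply, Pi.single_eq_same,
        Submodule.mkQ_apply]
      rw [Submodule.Quotient.eq]
      exact h1
    · simp only [Ψ, LinearMap.pi_apply, LinearMap.single_apply, Pi.single_eq_of_ne hj,
        Submodule.mkQ_apply, Submodule.Quotient.mk_eq_zero]
      exact h2 j hj
  rw [← (Submodule.quotEquivOfEq _ _ hker).finrank_eq,
    (Ψ.quotKerEquivOfSurjective (LinearMap.range_eq_top.1 hsurj)).finrank_eq,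
    Module.finrank_pi_fintype]

theorem hilbertFunction_iInf {ι : Type*} [Fintype ι] {J : ι → Ideal (CoordRing K n)} {t : ℕ}
    (h : ∀ i, ∀ f ∈ homogeneousSubmodule (Fin (n + 1)) K t,
      ∃ F ∈ homogeneousSubmodule (Fin (n + 1)) K t, F - f ∈ J i ∧ ∀ j, j ≠ i → F ∈ J j) :
    hilbertFunction (⨅ i, J i) t = ∑ i, hilbertFunction (J i) t := by
  have h1 := finrank_quotient_iInf (K := K) (V := homogeneousSubmodule (Fin (n + 1)) K t)
    (A := fun i => ((J i).restrictScalars K).submoduleOf _) (by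
      rintro i ⟨f, hf⟩
      obtain ⟨F, hF, h1, h2⟩ := h i f hf
      exact ⟨⟨F, hF⟩, h1, h2⟩)
  have h2 : ((⨅ i, J i).restrictScalars K).submoduleOf (homogeneousSubmodule (Fin (n + 1)) K t) =
      ⨅ i, ((J i).restrictScalars K).submoduleOf (homogeneousSubmodule (Fin (n + 1)) K t) := by
    ext x
    rw [Submodule.mem_iInf]
    exact Submodule.mem_iInf J
  rw [hilbertFunction, h2, h1]
  rfl

/-- Multiplication by a nonzerodivisor is injective from degree `t` to degree `t + D` of the
quotient. Equal dimensions make it surjective. -/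
theorem exists_mul_sub_mem {J : Ideal (CoordRing K n)} {h : CoordRing K n} {D t : ℕ}
    (hD : h.IsHomogeneous D) (hJ : ∀ f, h * f ∈ J → f ∈ J)
    (hHF : hilbertFunction J t = hilbertFunction J (t + D))
    {f : CoordRing K n} (hf : f ∈ homogeneousSubmodule (Fin (n + 1)) K (t + D)) :
    ∃ q ∈ homogeneousSubmodule (Fin (n + 1)) K t, h * q - f ∈ J := by
  let μ : homogeneousSubmodule (Fin (n + 1)) K t →ₗ[K]
      homogeneousSubmodule (Fin (n + 1)) K (t + D) :=
    (LinearMap.mulLeft K h).restrict fun q hq => by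
      rw [mem_homogeneousSubmodule] at hq ⊢
      rw [add_comm t D]
      exact hD.mul hq
  let A := (J.restrictScalars K).submoduleOf (homogeneousSubmodule (Fin (n + 1)) K (t + D))
  let μ' := A.mkQ.comp μ
  have hker : LinearMap.ker μ' =
      (J.restrictScalars K).submoduleOf (homogeneousSubmodule (Fin (n + 1)) K t) := by
    ext x
    rw [LinearMap.mem_ker]
    simp only [μ', LinearMap.comp_apply, Submodule.mkQ_apply, Submodule.Quotient.mk_eq_zero]
    exact ⟨fun hx => hJ _ hx, fun hx => J.mul_mem_left h hx⟩
  have hrange : LinearMap.range μ' = ⊤ := by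
    apply Submodule.eq_top_of_finrank_eq
    rw [← μ'.quotKerEquivRange.finrank_eq, (Submodule.quotEquivOfEq _ _ hker).finrank_eq]
    exact hHF
  obtain ⟨q, hq⟩ := LinearMap.range_eq_top.1 hrange (A.mkQ ⟨f, hf⟩)
  refine ⟨q.1, q.2, ?_⟩
  exact (Submodule.Quotient.eq A).1 hq

/-- The Hilbert function of a finite intersection of powers of ideals of points. -/
theorem hilbertFunction_iInf_pointIdeal_pow {ι : Type*} [Fintype ι] {v : ι → Fin (n + 1) → K}
    (hv : ∀ i, v i ≠ 0)
    (hsep : ∀ i j, j ≠ i → ∃ c : Fin (n + 1) → K, ∑ k, c k * v i k ≠ 0 ∧ ∑ k, c k * v j k = 0)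
    (k : ℕ) :
    ∃ t₀, ∀ t, t₀ ≤ t →
      hilbertFunction (⨅ i, pointIdeal (v i) ^ (k + 1)) t = Fintype.card ι * (n + k).choose n := by
  classical
  choose! c hc1 hc2 using hsep
  -- A form of degree `D` vanishing to order `k + 1` at every other point but not at point `i`. Its
  -- multiples realise any class at `i` with zero class elsewhere.
  let h : ι → CoordRing K n := fun i => ∏ j ∈ Finset.univ.erase i, linForm (c i j) ^ (k + 1)
  let D := (Fintype.card ι - 1) * (k + 1)
  have hD : ∀ i, (h i).IsHomogeneous D := by
    intro i
    have h1 := IsHomogeneous.prod (Finset.univ.erase i) (fun j => linForm (c i j) ^ (k + 1))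
      (fun _ => k + 1) (fun j _ => by
        have := (isHomogeneous_linForm (c i j)).pow (k + 1)
        rwa [one_mul] at this)
    rwa [Finset.sum_const, Finset.card_erase_of_mem (Finset.mem_univ i), Finset.card_univ,
      smul_eq_mul] at h1
  have hmem : ∀ i j, j ≠ i → h i ∈ pointIdeal (v j) ^ (k + 1) := by
    intro i j hj
    refine Ideal.mem_of_dvd _ (Finset.dvd_prod_of_mem _ (Finset.mem_erase.2 ⟨hj, Finset.mem_univ j⟩))
      (Ideal.pow_mem_pow ?_ _)
    rw [mem_pointIdeal_of_isHomogeneous (isHomogeneous_linForm _), eval_linForm]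
    exact hc2 i j hj
  have hnot : ∀ i, h i ∉ pointIdeal (v i) := by
    intro i hi
    obtain ⟨j, hj, hji⟩ := (Ideal.IsPrime.prod_mem_iff).1 hi
    have h1 := (pointIdeal_isPrime (v i)).mem_of_pow_mem _ hji
    rw [mem_pointIdeal_of_isHomogeneous (isHomogeneous_linForm _), eval_linForm] at h1
    exact hc1 i j (Finset.ne_of_mem_erase hj) h1
  -- Division by `h i` lowers the degree by `D`, and the Hilbert function at one point must already
  -- be stable, hence the degree at least `k`, after that.
  refine ⟨k + D, fun t ht => ?_⟩
  obtain ⟨s, rfl⟩ := Nat.exists_eq_add_of_le' (le_trans (Nat.le_add_left D k) ht)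
  rw [hilbertFunction_iInf]
  · rw [Finset.sum_congr rfl fun i _ => hilbertFunction_pointIdeal_pow (hv i) (by omega)]
    simp
  · intro i f hf
    obtain ⟨q, hq, hqf⟩ := exists_mul_sub_mem (J := pointIdeal (v i) ^ (k + 1)) (hD i)
      (fun f hf => mem_pow_of_mul_mem_pow (hv i) _ (hnot i) hf)
      (by rw [hilbertFunction_pointIdeal_pow (hv i) (by omega),
            hilbertFunction_pointIdeal_pow (hv i) (by omega)]) hf
    refine ⟨h i * q, ?_, hqf, fun j hj => Ideal.mul_mem_right _ _ (hmem i j hj)⟩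
    rw [mem_homogeneousSubmodule] at hq ⊢
    rw [add_comm s D]
    exact (hD i).mul hq

/-- The forms `q_a x_b - q_b x_a` vanish at `q`. If all of them vanished at `p`, the representatives
would be proportional. -/
theorem exists_linForm_separating {p q : ℙ K (Fin (n + 1) → K)} (h : q ≠ p) :
    ∃ c : Fin (n + 1) → K, ∑ k, c k * p.rep k ≠ 0 ∧ ∑ k, c k * q.rep k = 0 := by
  classical
  by_contra! H
  have h1 : ∀ a b, q.rep a * p.rep b = q.rep b * p.rep a := by
    intro a b
    by_contra hne
    have hs : ∀ w : Fin (n + 1) → K, ∑ k, (Pi.single b (q.rep a) - Pi.single a (q.rep b) :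
        Fin (n + 1) → K) k * w k = q.rep a * w b - q.rep b * w a := by
      intro w
      simp only [Pi.sub_apply, sub_mul, Finset.sum_sub_distrib]
      rw [Finset.sum_eq_single b, Finset.sum_eq_single a] <;>
        simp +contextual
    refine H (Pi.single b (q.rep a) - Pi.single a (q.rep b)) ?_ ?_
    · rw [hs]; exact sub_ne_zero.2 hne
    · rw [hs]; ring
  obtain ⟨a, ha⟩ := Function.ne_iff.1 q.rep_nonzero
  apply h
  rw [← p.mk_rep, ← q.mk_rep, eq_comm, Projectivization.mk_eq_mk_iff']
  refine ⟨p.rep a / q.rep a, ?_⟩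
  ext b
  rw [Pi.smul_apply, smul_eq_mul, div_mul_eq_mul_div, div_eq_iff ha]
  linear_combination -h1 a b

end Intersection

/-! ### Symbolic powers of ideals of points -/

section SymbolicPoints

variable {K : Type*} [Field K] {n : ℕ} (S : Finset (ℙ K (Fin (n + 1) → K)))

theorem symbolicPower_pointsIdeal (m : ℕ) :
    symbolicPower (pointsIdeal S) m = ⨅ p : S, pointIdeal p.1.rep ^ m := by
  rw [pointsIdeal_eq_iInf]
  refine symbolicPower_iInf (fun p => pointIdeal_isPrime _) (fun p q h => ?_) m
    fun p s f => mem_pow_of_mul_mem_pow p.1.rep_nonzero m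
  by_contra hne
  obtain ⟨c, hc1, hc2⟩ := exists_linForm_separating (p := q.1) (q := p.1)
    fun h => hne (Subtype.ext h)
  have h1 : linForm c ∈ pointIdeal p.1.rep := by
    rw [mem_pointIdeal_of_isHomogeneous (isHomogeneous_linForm c), eval_linForm]; exact hc2
  have h2 := h h1
  rw [mem_pointIdeal_of_isHomogeneous (isHomogeneous_linForm c), eval_linForm] at h2
  exact hc1 h2

theorem isHomog_symbolicPower (m : ℕ) : IsHomog (symbolicPower (pointsIdeal S) m) := by
  rw [symbolicPower_pointsIdeal]
  exact isHomog_iInf fun p => isHomog_pow (isHomog_pointIdeal _) m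

theorem symbolicPower_mul_le (a b : ℕ) :
    symbolicPower (pointsIdeal S) a * symbolicPower (pointsIdeal S) b ≤
      symbolicPower (pointsIdeal S) (a + b) := by
  simp only [symbolicPower_pointsIdeal]
  refine le_iInf fun p => ?_
  rw [pow_add]
  exact Ideal.mul_mono (iInf_le _ p) (iInf_le _ p)

theorem hilbertFunction_symbolicPower (k : ℕ) :
    ∃ t₀, ∀ t, t₀ ≤ t → hilbertFunction (symbolicPower (pointsIdeal S) (k + 1)) t =
      S.card * (n + k).choose n := by
  rw [symbolicPower_pointsIdeal]
  obtain ⟨t₀, h⟩ := hilbertFunction_iInf_pointIdeal_pow (v := fun p : S => p.1.rep)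
    (fun p => p.1.rep_nonzero)
    (fun p q h => exists_linForm_separating fun h' => h (Subtype.ext h')) k
  refine ⟨t₀, fun t ht => ?_⟩
  rw [h t ht, Fintype.card_coe]

theorem isHilbertPolynomial_symbolicPower (k : ℕ) :
    IsHilbertPolynomial (symbolicPower (pointsIdeal S) (k + 1))
      (Polynomial.C ((S.card * (n + k).choose n : ℕ) : ℚ)) := by
  obtain ⟨t₀, h⟩ := hilbertFunction_symbolicPower S k
  filter_upwards [Filter.eventually_ge_atTop t₀] with t ht
  rw [Polynomial.eval_C, h t ht]

theorem hilbertPolynomial_spec {J : Ideal (CoordRing K n)} {P : Polynomial ℚ}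
    (h : IsHilbertPolynomial J P) : hilbertPolynomial J = P := by
  have h1 : ∃ P, IsHilbertPolynomial J P := ⟨P, h⟩
  rw [hilbertPolynomial, dif_pos h1]
  exact h1.choose_spec.unique h

end SymbolicPoints

/-! ### Generic coordinates -/

section Generic

variable {K : Type*} [Field K] {n : ℕ}

theorem coordChange_X_last (g : GL (Fin (n + 1)) K) :
    coordChange g (X (Fin.last n)) = linForm fun i => g.1 i (Fin.last n) := by
  rw [coordChange, aeval_X, linForm]

/-- The last variable does not vanish at a given point in general coordinates. -/
theorem exists_generic_last_ne_zero {v : Fin (n + 1) → K} (hv : v ≠ 0) :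
    ∃ G : MvPolynomial (Fin (n + 1) × Fin (n + 1)) K, G ≠ 0 ∧ ∀ g : GL (Fin (n + 1)) K,
      eval (fun ij => g.1 ij.1 ij.2) G ≠ 0 →
        ∑ i, (g⁻¹).1 i (Fin.last n) * v i ≠ 0 := by
  -- The condition on `g⁻¹` becomes polynomial after multiplication by `det g`, with the adjugate in
  -- place of the inverse.
  let G : MvPolynomial (Fin (n + 1) × Fin (n + 1)) K :=
    ∑ i, (Matrix.mvPolynomialX (Fin (n + 1)) (Fin (n + 1)) K).adjugate i (Fin.last n) * C (v i)
  have hG : ∀ g : GL (Fin (n + 1)) K, eval (fun ij => g.1 ij.1 ij.2) G =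
      g.1.det * ∑ i, (g⁻¹).1 i (Fin.last n) * v i := by
    intro g
    have h1 : (eval fun ij => g.1 ij.1 ij.2).mapMatrix
        (Matrix.mvPolynomialX (Fin (n + 1)) (Fin (n + 1)) K) = g.1 := by
      ext i j; simp
    have h2 : g.1.adjugate = g.1.det • (g⁻¹).1 := by
      have h3 : g.1 * (g⁻¹).1 = 1 := by rw [← Units.val_mul, mul_inv_cancel]; rfl
      calc g.1.adjugate = g.1.adjugate * (g.1 * (g⁻¹).1) := by rw [h3, mul_one]
        _ = g.1.det • (g⁻¹).1 := by
          rw [← mul_assoc, Matrix.adjugate_mul, Matrix.smul_mul, one_mul]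
    have h4 : ∀ i j, eval (fun ij => g.1 ij.1 ij.2)
        ((Matrix.mvPolynomialX (Fin (n + 1)) (Fin (n + 1)) K).adjugate i j) =
          g.1.det * (g⁻¹).1 i j := by
      intro i j
      have h5 := congrFun (congrFun (RingHom.map_adjugate (eval fun ij => g.1 ij.1 ij.2)
        (Matrix.mvPolynomialX (Fin (n + 1)) (Fin (n + 1)) K)) i) j
      rw [h1, h2] at h5
      exact h5
    simp only [G, map_sum, map_mul, eval_C, h4, Finset.mul_sum, mul_assoc]
  refine ⟨G, fun h0 => ?_, fun g hg h => hg (by rw [hG, h, mul_zero])⟩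
  -- `G` is nonzero: when the last column of `g⁻¹` is a `c` with `∑ c j * v j = 1`, its value is
  -- `det g`.
  obtain ⟨c, hc⟩ := exists_dual hv
  have hc0 : c ≠ 0 := by
    rintro rfl
    simp at hc
  obtain ⟨N, hN⟩ := exists_GL_last_row hc0
  let N' : GL (Fin (n + 1)) K := Matrix.GeneralLinearGroup.mkOfDetNeZero N.1.transpose (by
    rw [Matrix.det_transpose]
    exact (Matrix.isUnit_iff_isUnit_det N.1).1 N.isUnit |>.ne_zero)
  have h1 := hG N'⁻¹
  rw [h0, map_zero, inv_inv] at h1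
  have h2 : ∑ i, N'.1 i (Fin.last n) * v i = 1 := by
    rw [← hc]
    refine Finset.sum_congr rfl fun i _ => ?_
    rw [← hN i]
    rfl
  rw [h2, mul_one] at h1
  exact ((Matrix.isUnit_iff_isUnit_det (N'⁻¹).1).1 (N'⁻¹).isUnit).ne_zero h1.symm

/-- Pulled back by `g`, the last variable is a linear form vanishing at no point of `S`, so it
cancels modulo each primary component. -/
theorem mem_map_of_X_last_mul_mem {S : Finset (ℙ K (Fin (n + 1) → K))} {m : ℕ}
    {g : GL (Fin (n + 1)) K}
    (hg : ∀ p ∈ S, ∑ i, (g⁻¹).1 i (Fin.last n) * p.rep i ≠ 0) {f : CoordRing K n}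
    (hf : X (Fin.last n) * f ∈ (symbolicPower (pointsIdeal S) m).map (coordChange g)) :
    f ∈ (symbolicPower (pointsIdeal S) m).map (coordChange g) := by
  rw [mem_map_coordChange, symbolicPower_pointsIdeal, Submodule.mem_iInf] at hf ⊢
  intro p
  refine mem_pow_of_mul_mem_pow p.1.rep_nonzero m ?_ (map_mul (coordChange g⁻¹) _ _ ▸ hf p)
  rw [coordChange_X_last, mem_pointIdeal_of_isHomogeneous (isHomogeneous_linForm _), eval_linForm]
  exact hg p.1 p.2

/-- If the last variable is a nonzerodivisor modulo a homogeneous ideal, then so it is modulo its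
degree reverse lexicographic initial ideal. -/
theorem mem_leadingExponents_of_add_single_last {J : Ideal (CoordRing K n)} (hJ : IsHomog J)
    (hX : ∀ f, X (Fin.last n) * f ∈ J → f ∈ J) {α : Fin (n + 1) →₀ ℕ}
    (h : α + Finsupp.single (Fin.last n) 1 ∈ leadingExponents J) : α ∈ leadingExponents J := by
  classical
  set d := (α + Finsupp.single (Fin.last n) 1).degree with hd
  obtain ⟨⟨f, hfJ, hfd⟩, h1, h2⟩ := (mem_leadingExponents_iff hJ ⟨_, hd.symm⟩).1 h
  -- The characteristic property of degrevlex: in a given degree, a monomial without the last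
  -- variable exceeds every monomial containing it. So if the leading monomial of a form contains
  -- it, all its monomials do.
  have hlast : ∀ β ∈ f.support, Finsupp.single (Fin.last n) 1 ≤ β := by
    intro β hβ
    have hβd : β.degree = d := by
      by_contra h0
      exact mem_support_iff.1 hβ (((mem_homogeneousSubmodule _ _).1 hfd).coeff_eq_zero h0)
    rw [Finsupp.single_le_iff]
    by_contra h0
    refine mem_support_iff.1 hβ (h2 ⟨β, hβd⟩ (lt_iff_degRevLexLT.2 (Or.inr ⟨hβd.symm ▸ hd.symm,
      Fin.last n, fun j hj => absurd (Fin.le_last j) (not_le.2 hj), ?_⟩)))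
    simp only [Finsupp.add_apply, Finsupp.single_eq_same]
    omega
  have hdvd : X (Fin.last n) ∣ f := by
    rw [X_dvd_iff_modMonomial_eq_zero]
    ext β
    rw [coeff_zero]
    by_cases hβ : Finsupp.single (Fin.last n) 1 ≤ β
    · exact coeff_modMonomial_of_le _ hβ
    · rw [coeff_modMonomial_of_not_le _ hβ]
      by_contra h0
      exact hβ (hlast β (mem_support_iff.2 h0))
  obtain ⟨f', rfl⟩ := hdvd
  have hcoeff : ∀ β, coeff (β + Finsupp.single (Fin.last n) 1) (X (Fin.last n) * f') = coeff β f' :=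
    fun β => by rw [mul_comm, coeff_mul_X]
  have hf'd : f' ∈ homogeneousSubmodule (Fin (n + 1)) K α.degree := by
    intro β hβ
    rw [← hcoeff] at hβ
    have h3 : (β + Finsupp.single (Fin.last n) 1).degree = d := by
      by_contra h0
      exact hβ (((mem_homogeneousSubmodule _ _).1 hfd).coeff_eq_zero h0)
    rw [hd, map_add, map_add] at h3
    have h4 : Finsupp.weight 1 β = β.degree :=
      (DFunLike.congr_fun (Finsupp.degree_eq_weight_one (R := ℕ)) β).symm
    rw [h4]
    exact add_right_cancel h3
  refine (mem_leadingExponents_iff hJ ⟨α, rfl⟩).2 ⟨⟨f', hX f' hfJ, hf'd⟩, ?_, fun β hβ => ?_⟩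
  · rw [degreeCoeffs_apply] at h1 ⊢
    rwa [hcoeff] at h1
  · rw [degreeCoeffs_apply, ← hcoeff]
    exact h2 ⟨β.1 + Finsupp.single (Fin.last n) 1, by rw [hd, map_add, map_add, β.2]⟩
      (lt_iff_degRevLexLT.2 ((lt_iff_degRevLexLT.1 hβ).add_right _))

end Generic

/-! ### Counting exponents in the first variables -/

section Count

variable {n : ℕ}

/-- An exponent in the first variables as an exponent in all variables. -/
def extendExp (α : Fin n →₀ ℕ) : Fin (n + 1) →₀ ℕ := α.mapDomain Fin.castSucc

theorem extendExp_castSucc (α : Fin n →₀ ℕ) (i : Fin n) : extendExp α i.castSucc = α i :=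
  Finsupp.mapDomain_apply (Fin.castSucc_injective n) _ _

theorem extendExp_last (α : Fin n →₀ ℕ) : extendExp α (Fin.last n) = 0 := by
  refine Finsupp.mapDomain_of_notMem_range _ _ ?_
  rintro ⟨i, hi⟩
  exact Fin.castSucc_ne_last i hi

theorem extendExp_add (α β : Fin n →₀ ℕ) : extendExp (α + β) = extendExp α + extendExp β :=
  Finsupp.mapDomain_add

theorem degree_extendExp (α : Fin n →₀ ℕ) : (extendExp α).degree = α.degree := by
  rw [degree_eq_initDegree_add, extendExp_last, add_zero, initDegree, Finsupp.degree_eq_sum]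
  simp only [extendExp_castSucc]

theorem extendExp_comapDomain_add (α : Fin (n + 1) →₀ ℕ) :
    extendExp (α.comapDomain Fin.castSucc (Fin.castSucc_injective n).injOn) +
      Finsupp.single (Fin.last n) (α (Fin.last n)) = α := by
  ext i
  refine Fin.lastCases ?_ (fun i => ?_) i
  · simp [extendExp_last]
  · simp [extendExp_castSucc]

theorem add_single_last_mem_iff {E : Set (Fin (n + 1) →₀ ℕ)}
    (hE : ∀ α, α + Finsupp.single (Fin.last n) 1 ∈ E ↔ α ∈ E) (α : Fin (n + 1) →₀ ℕ) (c : ℕ) :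
    α + Finsupp.single (Fin.last n) c ∈ E ↔ α ∈ E := by
  induction c with
  | zero => simp
  | succ c ih => rw [Finsupp.single_add, ← add_assoc, hE, ih]

/-- Membership in `E` ignores the last entry, so dropping it identifies the missing exponents of
degree `t` with the missing exponents of degree at most `t` in `n` variables. A count that
stabilises forces the latter set to be finite. -/
theorem ncard_compl_extendExp {E : Set (Fin (n + 1) →₀ ℕ)}
    (hE : ∀ α, α + Finsupp.single (Fin.last n) 1 ∈ E ↔ α ∈ E) {c t₀ : ℕ}
    (hc : ∀ t, t₀ ≤ t → Nat.card {α : DegExp n t // α.1 ∉ E} = c) :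
    {α | extendExp α ∉ E}.Finite ∧ {α | extendExp α ∉ E}.ncard = c := by
  have hdeg : ∀ t, Set.BijOn (fun α : DegExp n t =>
      α.1.comapDomain Fin.castSucc (Fin.castSucc_injective n).injOn)
      {α : DegExp n t | α.1 ∉ E} {α | extendExp α ∉ E ∧ α.degree ≤ t} := by
    intro t
    refine ⟨?_, ?_, ?_⟩
    · intro α hα
      have h1 := extendExp_comapDomain_add α.1
      refine ⟨?_, ?_⟩
      · rw [← add_single_last_mem_iff hE _ (α.1 (Fin.last n)), h1]; exact hα
      · have h2 := congrArg Finsupp.degree h1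
        rw [map_add, degree_extendExp, α.2] at h2
        exact (Nat.le_add_right _ _).trans h2.le
    · intro α _ β _ hαβ
      have h1 := extendExp_comapDomain_add α.1
      have h2 := extendExp_comapDomain_add β.1
      simp only at hαβ
      rw [hαβ] at h1
      have h3 := congrArg Finsupp.degree h1
      have h4 := congrArg Finsupp.degree h2
      rw [map_add, α.2, Finsupp.degree_single] at h3
      rw [map_add, β.2, Finsupp.degree_single] at h4
      have h5 : α.1 (Fin.last n) = β.1 (Fin.last n) := by omega
      exact DegExp.ext (h1.symm.trans (by rw [h5, h2]))
    · rintro α ⟨hα, hd⟩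
      refine ⟨⟨extendExp α + Finsupp.single (Fin.last n) (t - α.degree), ?_⟩, ?_, ?_⟩
      · rw [map_add, degree_extendExp, Finsupp.degree_single]; omega
      · rw [Set.mem_ofPred_eq, add_single_last_mem_iff hE]; exact hα
      · ext i
        simp [extendExp_castSucc]
  have hcard : ∀ t, t₀ ≤ t → {α | extendExp α ∉ E ∧ α.degree ≤ t}.ncard = c := by
    intro t ht
    rw [← (hdeg t).image_eq, Set.InjOn.ncard_image (hdeg t).injOn, ← hc t ht]
    rfl
  have hfin : ∀ t, {α : Fin n →₀ ℕ | extendExp α ∉ E ∧ α.degree ≤ t}.Finite := fun t => by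
    rw [← (hdeg t).image_eq]; exact (Set.toFinite _).image _
  have hF : {α | extendExp α ∉ E}.Finite := by
    by_contra hinf
    obtain ⟨T, hT, hTc⟩ := Set.Infinite.exists_subset_card_eq hinf (c + 1)
    have h1 := Set.ncard_le_ncard (s := (T : Set (Fin n →₀ ℕ)))
      (t := {α | extendExp α ∉ E ∧ α.degree ≤ max t₀ (T.sup Finsupp.degree)})
      (fun α hα => ⟨hT hα, (Finset.le_sup (f := Finsupp.degree) hα).trans (le_max_right _ _)⟩)
      (hfin _)
    rw [hcard _ (le_max_left _ _), Set.ncard_coe_finset, hTc] at h1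
    omega
  refine ⟨hF, ?_⟩
  rw [← hcard (max t₀ (hF.toFinset.sup Finsupp.degree)) (le_max_left _ _)]
  congr 1
  ext α
  exact ⟨fun h => ⟨h, (Finset.le_sup (f := Finsupp.degree) (hF.mem_toFinset.2 h)).trans
    (le_max_right _ _)⟩, fun h => h.1⟩

end Count

/-! ### The generic initial ideals of the symbolic powers -/

section GinSymbolic

variable {K : Type*} [Field K] {n : ℕ} (S : Finset (ℙ K (Fin (n + 1) → K)))

/-- The exponents of the monomials of the generic initial ideal of a symbolic power which do not
involve the last variable. -/
def ginExponents (m : ℕ) : Set (Fin n →₀ ℕ) :=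
  {α | monomial α (1 : K) ∈ ginTrunc (symbolicPower (pointsIdeal S) m)}

/-- Finitely many nonempty open conditions have a common point, so several generic initial ideals
can be computed in the same coordinates. -/
theorem exists_generic_coordinates [Infinite K] (M : Finset ℕ) :
    ∃ g : GL (Fin (n + 1)) K,
      (∀ p ∈ S, ∑ i, (g⁻¹).1 i (Fin.last n) * p.rep i ≠ 0) ∧
      ∀ m ∈ M, ∀ α, α ∈ ginExponents S m ↔
        extendExp α ∈ leadingExponents ((symbolicPower (pointsIdeal S) m).map (coordChange g)) := by
  classical
  choose F hF hFg using fun m => gin_spec (isHomog_symbolicPower S m)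
  choose G hG hGg using fun p : ℙ K (Fin (n + 1) → K) => exists_generic_last_ne_zero p.rep_nonzero
  obtain ⟨g, hg⟩ := exists_GL_eval_ne_zero (F := (∏ m ∈ M, F m) * ∏ p ∈ S, G p)
    (mul_ne_zero (Finset.prod_ne_zero_iff.2 fun m _ => hF m)
      (Finset.prod_ne_zero_iff.2 fun p _ => hG p))
  rw [map_mul, map_prod, map_prod] at hg
  refine ⟨g, fun p hp => hGg p g (Finset.prod_ne_zero_iff.1 (right_ne_zero_of_mul hg) p hp),
    fun m hm α => ?_⟩
  rw [← monomial_mem_initialIdeal_iff,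
    hFg m g (Finset.prod_ne_zero_iff.1 (left_ne_zero_of_mul hg) m hm), ginExponents,
    Set.mem_ofPred_eq, ginTrunc, Ideal.mem_comap, rename_monomial]
  rfl

theorem add_mem_ginExponents [Infinite K] {a b : ℕ} {α β : Fin n →₀ ℕ} (hα : α ∈ ginExponents S a)
    (hβ : β ∈ ginExponents S b) : α + β ∈ ginExponents S (a + b) := by
  obtain ⟨g, -, hg⟩ := exists_generic_coordinates S {a, b, a + b}
  rw [hg _ (by simp)] at hα hβ ⊢
  rw [extendExp_add]
  refine add_mem_leadingExponents ?_ hα hβ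
  rw [← Ideal.map_mul]
  exact Ideal.map_mono (symbolicPower_mul_le S a b)

theorem isUpperSet_ginExponents (m : ℕ) : IsUpperSet (ginExponents S m) := by
  intro α β h hα
  obtain ⟨γ, rfl⟩ := le_iff_exists_add.1 h
  have : monomial (α + γ) (1 : K) = monomial α 1 * monomial γ 1 := by simp [monomial_mul]
  rw [ginExponents, Set.mem_ofPred_eq, this]
  exact Ideal.mul_mem_right _ _ hα

theorem ncard_compl_ginExponents [Infinite K] (k : ℕ) :
    (ginExponents S (k + 1))ᶜ.Finite ∧
      (ginExponents S (k + 1))ᶜ.ncard = S.card * (n + k).choose n := by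
  obtain ⟨g, hg1, hg2⟩ := exists_generic_coordinates S {k + 1}
  set J := symbolicPower (pointsIdeal S) (k + 1) with hJdef
  have hJ : IsHomog (J.map (coordChange g)) := (isHomog_symbolicPower S (k + 1)).map_coordChange g
  have h1 : (ginExponents S (k + 1))ᶜ =
      {α | extendExp α ∉ leadingExponents (J.map (coordChange g))} := by
    ext α
    rw [Set.mem_compl_iff, hg2 _ (by simp)]
    rfl
  obtain ⟨t₀, ht⟩ := hilbertFunction_symbolicPower S k
  rw [h1]
  refine ncard_compl_extendExp (fun α => ⟨fun h => ?_, fun h => ?_⟩) (t₀ := t₀) fun t h => ?_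
  · exact mem_leadingExponents_of_add_single_last hJ
      (fun f hf => mem_map_of_X_last_mul_mem hg1 hf) h
  · exact leadingExponents_mono_le h (le_add_of_nonneg_right (zero_le))
  · rw [← hilbertFunction_eq_card hJ, hilbertFunction_map_coordChange, ht t h]

end GinSymbolic

/-! ### Limiting shapes of graded systems of sets of exponents -/

section Shape

open MeasureTheory Set Filter Topology

variable {n : ℕ}

/-- The union of the orthants with vertices `α / m`, `α ∈ B`. -/
def scaledRegion (B : Set (Fin n →₀ ℕ)) (m : ℕ) : Set (Fin n → ℝ) :=
  {x | ∃ α ∈ B, ∀ i, (α i : ℝ) ≤ m * x i}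

/-- The nonnegative orthant. -/
def orthant (n : ℕ) : Set (Fin n → ℝ) := {x | ∀ i, 0 ≤ x i}

theorem isUpperSet_scaledRegion (B : Set (Fin n →₀ ℕ)) (m : ℕ) :
    IsUpperSet (scaledRegion B m) := by
  rintro x y h ⟨α, hα, hx⟩
  exact ⟨α, hα, fun i => (hx i).trans (mul_le_mul_of_nonneg_left (h i) (Nat.cast_nonneg m))⟩

theorem isClosed_orthant (n : ℕ) : IsClosed (orthant n) := by
  have : orthant n = ⋂ i, {x | 0 ≤ x i} := by ext; simp [orthant]
  rw [this]
  exact isClosed_iInter fun i => isClosed_le continuous_const (continuous_apply i)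

/-- The cube containing `x` has corner `⌊m x⌋ / m`, and for an upper set only that corner matters.
-/
theorem orthant_sdiff_scaledRegion {B : Set (Fin n →₀ ℕ)} (hB : IsUpperSet B) {m : ℕ}
    (hm : 0 < m) : orthant n \ scaledRegion B m =
      ⋃ α ∈ Bᶜ, univ.pi fun i => Ico ((α i : ℝ) / m) ((α i + 1 : ℝ) / m) := by
  have hm' : (0 : ℝ) < m := Nat.cast_pos.2 hm
  ext x
  simp only [mem_iUnion, Set.mem_pi, mem_univ, true_imp_iff, mem_Ico, exists_prop, Set.mem_sdiff]
  constructor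
  · rintro ⟨h0, h⟩
    have hx : ∀ i, 0 ≤ m * x i := fun i => mul_nonneg hm'.le (h0 i)
    let α : Fin n →₀ ℕ := Finsupp.equivFunOnFinite.symm fun i => ⌊m * x i⌋₊
    have hα : ∀ i, α i = ⌊m * x i⌋₊ := fun i => rfl
    refine ⟨α, fun hα => h ⟨α, hα, fun i => Nat.floor_le (hx i)⟩, fun i => ⟨?_, ?_⟩⟩
    · rw [div_le_iff₀ hm', mul_comm (x i), hα]; exact Nat.floor_le (hx i)
    · rw [lt_div_iff₀ hm', mul_comm (x i), hα]; exact Nat.lt_floor_add_one _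
  · rintro ⟨α, hα, h⟩
    refine ⟨fun i => (by positivity : (0 : ℝ) ≤ α i / m).trans (h i).1, ?_⟩
    rintro ⟨β, hβ, hx⟩
    refine hα (hB (fun i => ?_) hβ)
    have h1 := (lt_div_iff₀ hm').1 (h i).2
    rw [mul_comm] at h1
    have h2 := (hx i).trans_lt h1
    exact Nat.lt_succ_iff.1 (by exact_mod_cast h2)

theorem volume_orthant_sdiff_scaledRegion {B : Set (Fin n →₀ ℕ)} (hB : IsUpperSet B)
    (hfin : Bᶜ.Finite) {m : ℕ} (hm : 0 < m) :
    volume (orthant n \ scaledRegion B m) = ENNReal.ofReal ((Bᶜ.ncard : ℝ) / (m : ℝ) ^ n) := by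
  have hm' : (0 : ℝ) < m := Nat.cast_pos.2 hm
  rw [orthant_sdiff_scaledRegion hB hm]
  have h1 : ∀ α : Fin n →₀ ℕ, volume (univ.pi fun i => Ico ((α i : ℝ) / m) ((α i + 1 : ℝ) / m)) =
      ENNReal.ofReal (1 / (m : ℝ) ^ n) := by
    intro α
    rw [Real.volume_pi_Ico]
    have : ∀ i, (α i + 1 : ℝ) / m - (α i : ℝ) / m = 1 / m := fun i => by ring
    simp only [this, Finset.prod_const, Finset.card_univ, Fintype.card_fin]
    rw [← ENNReal.ofReal_pow (by positivity), one_div_pow]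
  have h2 : (⋃ α ∈ Bᶜ, univ.pi fun i => Ico ((α i : ℝ) / m) ((α i + 1 : ℝ) / m)) =
      ⋃ α ∈ hfin.toFinset, univ.pi fun i => Ico ((α i : ℝ) / m) ((α i + 1 : ℝ) / m) := by
    simp only [Finite.mem_toFinset]
  rw [h2, measure_biUnion_finset]
  · simp only [h1, Finset.sum_const, nsmul_eq_mul]
    rw [ncard_eq_toFinset_card _ hfin, ← ENNReal.ofReal_natCast,
      ← ENNReal.ofReal_mul (Nat.cast_nonneg _), mul_one_div]
  · intro α _ β _ hne
    refine Set.disjoint_left.2 fun x hx hy => hne ?_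
    ext i
    have hxi := hx i (mem_univ i)
    have hyi := hy i (mem_univ i)
    have h3 := (div_lt_div_iff_of_pos_right hm').1 (hxi.1.trans_lt hyi.2)
    have h4 := (div_lt_div_iff_of_pos_right hm').1 (hyi.1.trans_lt hxi.2)
    have h5 : α i < β i + 1 := by exact_mod_cast h3
    have h6 : β i < α i + 1 := by exact_mod_cast h4
    omega
  · exact fun α _ => MeasurableSet.univ_pi fun i => measurableSet_Ico

/-- A family of sets of exponents with `A a + A b ⊆ A (a + b)`. -/
structure IsGradedSystem (A : ℕ → Set (Fin n →₀ ℕ)) : Prop where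
  isUpperSet : ∀ m, IsUpperSet (A m)
  add_mem : ∀ {a b α β}, α ∈ A a → β ∈ A b → α + β ∈ A (a + b)

variable {A : ℕ → Set (Fin n →₀ ℕ)}

/-- The union of the scaled regions of a graded system. -/
def limitRegion (A : ℕ → Set (Fin n →₀ ℕ)) : Set (Fin n → ℝ) :=
  ⋃ (m : ℕ) (_ : 1 ≤ m), scaledRegion (A m) m

theorem mem_limitRegion {x : Fin n → ℝ} :
    x ∈ limitRegion A ↔ ∃ m, 1 ≤ m ∧ x ∈ scaledRegion (A m) m := by
  simp [limitRegion]

theorem IsGradedSystem.nsmul_mem (hA : IsGradedSystem A) {k a : ℕ} (hk : 1 ≤ k) {α : Fin n →₀ ℕ}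
    (hα : α ∈ A a) : k • α ∈ A (k * a) := by
  induction k, hk using Nat.le_induction with
  | base => simpa using hα
  | succ k _ ih => rw [succ_nsmul, Nat.succ_mul]; exact hA.add_mem ih hα

theorem IsGradedSystem.scaledRegion_subset_mul (hA : IsGradedSystem A) {k a : ℕ} (hk : 1 ≤ k) :
    scaledRegion (A a) a ⊆ scaledRegion (A (k * a)) (k * a) := by
  rintro x ⟨α, hα, hx⟩
  refine ⟨k • α, hA.nsmul_mem hk hα, fun i => ?_⟩
  have := mul_le_mul_of_nonneg_left (hx i) (Nat.cast_nonneg (α := ℝ) k)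
  simpa [mul_assoc] using this

theorem isUpperSet_limitRegion (A : ℕ → Set (Fin n →₀ ℕ)) : IsUpperSet (limitRegion A) :=
  isUpperSet_iUnion₂ fun _ _ => isUpperSet_scaledRegion _ _

theorem IsGradedSystem.rat_combination_mem (hA : IsGradedSystem A) {x y : Fin n → ℝ}
    (hx : x ∈ limitRegion A) (hy : y ∈ limitRegion A) {s : ℚ} (hs0 : 0 < s) (hs1 : s < 1) :
    (s : ℝ) • x + (1 - s : ℝ) • y ∈ limitRegion A := by
  obtain ⟨a, ha, α, hα, hx⟩ := mem_limitRegion.1 hx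
  obtain ⟨b, hb, β, hβ, hy⟩ := mem_limitRegion.1 hy
  obtain ⟨p, hp⟩ := Int.eq_ofNat_of_zero_le (Rat.num_nonneg.2 hs0.le)
  have hp0 : 1 ≤ p := by
    have := Rat.num_pos.2 hs0
    omega
  have hd : (0 : ℝ) < s.den := Nat.cast_pos.2 s.den_pos
  have hsp : (s : ℝ) = p / s.den := by
    rw [Rat.cast_def, hp]; simp
  have hpd : p < s.den := by
    have h1 : (s : ℝ) < 1 := by exact_mod_cast hs1
    rw [hsp, div_lt_one hd] at h1
    exact_mod_cast h1
  obtain ⟨q, hq⟩ := Nat.exists_eq_add_of_lt hpd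
  have hq' : s.den = p + (q + 1) := hq
  have hda : 1 ≤ a * b := Nat.one_le_iff_ne_zero.2 (by positivity)
  -- With `s = p / (p + q + 1)`, the common level is `a * b * (p + q + 1)`. The multiples of `α` and
  -- `β` bring weights `s` and `1 - s` there.
  refine mem_limitRegion.2 ⟨(p * b) * a + ((q + 1) * a) * b, ?_, (p * b) • α + ((q + 1) * a) • β,
    hA.add_mem (hA.nsmul_mem ?_ hα) (hA.nsmul_mem ?_ hβ), fun i => ?_⟩
  · have : 0 < p * b * a := by positivity
    omega
  · exact Nat.one_le_iff_ne_zero.2 (by positivity)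
  · exact Nat.one_le_iff_ne_zero.2 (by positivity)
  · have h1 : (s : ℝ) * (p + (q + 1)) = p := by
      have h2 : (s.den : ℝ) = p + (q + 1) := by exact_mod_cast hq'
      rw [hsp, h2]
      field_simp
    have h3 := mul_le_mul_of_nonneg_left (hx i) (by positivity : (0 : ℝ) ≤ p * b)
    have h4 := mul_le_mul_of_nonneg_left (hy i) (by positivity : (0 : ℝ) ≤ (q + 1) * a)
    simp only [Finsupp.add_apply, Finsupp.smul_apply, smul_eq_mul, Pi.add_apply, Pi.smul_apply]
    push_cast
    have h5 : ((p : ℝ) * b * a + (q + 1) * a * b) * (s * x i + (1 - s) * y i) =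
        p * b * (a * x i) + (q + 1) * a * (b * y i) := by
      have h6 : ((p : ℝ) * b * a + (q + 1) * a * b) * (s * x i + (1 - s) * y i) =
          a * b * ((s * (p + (q + 1))) * x i + ((p + (q + 1)) - s * (p + (q + 1))) * y i) := by ring
      rw [h6, h1]
      ring
    rw [h5]
    exact add_le_add h3 h4

/-- Rational weights are handled by the graded structure. Density of the rationals gives real
weights, and continuity in the endpoints extends this to the closure. -/
theorem IsGradedSystem.convex_closure_limitRegion (hA : IsGradedSystem A) :
    Convex ℝ (closure (limitRegion A)) := by
  rw [convex_iff_forall_pos]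
  intro x hx y hy a b ha hb hab
  obtain rfl : b = 1 - a := by linarith
  have key : ∀ x ∈ limitRegion A, ∀ y ∈ limitRegion A, a • x + (1 - a) • y ∈
      closure (limitRegion A) := by
    intro x hx y hy
    have h1 : a ∈ closure (Ioo (0 : ℝ) 1 ∩ range ((↑) : ℚ → ℝ)) :=
      Rat.isDenseEmbedding_coe_real.dense.open_subset_closure_inter isOpen_Ioo ⟨ha, by linarith⟩
    have hc : Continuous fun s : ℝ => s • x + (1 - s) • y := by fun_prop
    refine map_mem_closure (f := fun s : ℝ => s • x + (1 - s) • y) hc h1 ?_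
    rintro _ ⟨⟨h0, h2⟩, s, rfl⟩
    exact hA.rat_combination_mem hx hy (by exact_mod_cast h0) (by exact_mod_cast h2)
  have hc : Continuous fun z : (Fin n → ℝ) × (Fin n → ℝ) => a • z.1 + (1 - a) • z.2 := by fun_prop
  have h2 : (x, y) ∈ closure (limitRegion A ×ˢ limitRegion A) := by
    rw [closure_prod_eq]; exact ⟨hx, hy⟩
  have := map_mem_closure hc h2 fun z hz => key z.1 hz.1 z.2 hz.2
  rwa [closure_closure] at this

/-- Each level bounds the volume from above, and these bounds tend to `c`. From below, the set is a
decreasing intersection along the levels `k !`, cofinal for divisibility, of sets of volume at least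
`c`. -/
theorem IsGradedSystem.volume_orthant_sdiff_limitRegion (hA : IsGradedSystem A) {c : ℝ}
    (hfin : ∀ m, 1 ≤ m → (A m)ᶜ.Finite)
    (hge : ∀ m, 1 ≤ m → c ≤ ((A m)ᶜ.ncard : ℝ) / (m : ℝ) ^ n)
    (hlim : Tendsto (fun m : ℕ => ((A m)ᶜ.ncard : ℝ) / (m : ℝ) ^ n) atTop (𝓝 c)) :
    volume (orthant n \ limitRegion A) = ENNReal.ofReal c := by
  have hvol : ∀ m, 1 ≤ m → volume (orthant n \ scaledRegion (A m) m) =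
      ENNReal.ofReal (((A m)ᶜ.ncard : ℝ) / (m : ℝ) ^ n) := fun m hm =>
    volume_orthant_sdiff_scaledRegion (hA.isUpperSet m) (hfin m hm) hm
  apply le_antisymm
  · refine ge_of_tendsto ((ENNReal.continuous_ofReal.tendsto c).comp hlim) ?_
    filter_upwards [eventually_ge_atTop 1] with m hm
    rw [Function.comp_apply, ← hvol m hm]
    refine measure_mono (sdiff_subset_sdiff_right ?_)
    exact subset_iUnion₂ (s := fun m (_ : 1 ≤ m) => scaledRegion (A m) m) m hm
  · have hanti : Antitone fun k : ℕ => orthant n \ scaledRegion (A k !) k ! := by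
      refine antitone_nat_of_succ_le fun k => sdiff_subset_sdiff_right ?_
      rw [Nat.factorial_succ]
      exact hA.scaledRegion_subset_mul (Nat.succ_pos k)
    have hInter : orthant n \ limitRegion A = ⋂ k : ℕ, orthant n \ scaledRegion (A k !) k ! := by
      ext x
      simp only [Set.mem_sdiff, mem_limitRegion, mem_iInter, not_exists, not_and]
      constructor
      · exact fun h k => ⟨h.1, h.2 _ (Nat.factorial_pos k)⟩
      · refine fun h => ⟨(h 0).1, fun m hm hx => (h m).2 ?_⟩
        obtain ⟨k, rfl⟩ := Nat.exists_eq_add_of_le' hm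
        rw [Nat.factorial_succ, mul_comm]
        exact hA.scaledRegion_subset_mul (Nat.factorial_pos k) hx
    rw [hInter]
    refine ge_of_tendsto (tendsto_measure_iInter_atTop (fun k => ?_) hanti ⟨0, ?_⟩) ?_
    · exact (isClosed_orthant n).measurableSet.nullMeasurableSet.diff
        (isUpperSet_scaledRegion _ _).ordConnected.nullMeasurableSet
    · rw [hvol _ (Nat.factorial_pos 0)]; exact ENNReal.ofReal_ne_top
    · refine Eventually.of_forall fun k => ?_
      rw [Function.comp_apply, hvol _ (Nat.factorial_pos k)]
      exact ENNReal.ofReal_le_ofReal (hge _ (Nat.factorial_pos k))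

/-- The two sets differ only inside the frontier of `U`, and the frontier of an upper set is null.
-/
theorem volume_closure_orthant_sdiff {U P : Set (Fin n → ℝ)} (hU : IsUpperSet U) (hUP : U ⊆ P)
    (hPU : P ⊆ closure U) : volume (closure (orthant n \ P)) = volume (orthant n \ U) := by
  apply le_antisymm
  · have h1 : closure (orthant n \ P) ⊆ (orthant n \ U) ∪ frontier U := by
      have h2 : closure (orthant n \ P) ⊆ orthant n :=
        closure_minimal sdiff_subset (isClosed_orthant n)
      have h3 : closure (orthant n \ P) ⊆ closure Uᶜ :=
        closure_mono fun x hx hxU => hx.2 (hUP hxU)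
      intro x hx
      by_cases hxU : x ∈ U
      · right
        rw [frontier_eq_closure_inter_closure]
        exact ⟨subset_closure hxU, h3 hx⟩
      · exact Or.inl ⟨h2 hx, hxU⟩
    calc _ ≤ volume ((orthant n \ U) ∪ frontier U) := measure_mono h1
      _ ≤ volume (orthant n \ U) + volume (frontier U) := measure_union_le _ _
      _ = volume (orthant n \ U) := by rw [hU.null_frontier, add_zero]
  · have h1 : orthant n \ U ⊆ closure (orthant n \ P) ∪ frontier U := by
      intro x hx
      by_cases hxU : x ∈ closure U
      · exact Or.inr ⟨hxU, fun h => hx.2 (interior_subset h)⟩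
      · exact Or.inl (subset_closure ⟨hx.1, fun h => hxU (hPU h)⟩)
    calc _ ≤ volume (closure (orthant n \ P) ∪ frontier U) := measure_mono h1
      _ ≤ volume (closure (orthant n \ P)) + volume (frontier U) := measure_union_le _ _
      _ = volume (closure (orthant n \ P)) := by rw [hU.null_frontier, add_zero]

theorem scaledRegion_eq_smul (B : Set (Fin n →₀ ℕ)) {m : ℕ} (hm : 1 ≤ m) :
    scaledRegion B m = (m : ℝ)⁻¹ • {x : Fin n → ℝ | ∃ α ∈ B, ∀ i, (α i : ℝ) ≤ x i} := by
  have hm' : (m : ℝ) ≠ 0 := Nat.cast_ne_zero.2 (by omega)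
  ext x
  rw [mem_smul_set_iff_inv_smul_mem₀ (inv_ne_zero hm'), inv_inv]
  rfl

/-- The convex hulls lie between the limit region and its convex closure, so they do not affect the
volume. -/
theorem IsGradedSystem.volume_limitingShape (hA : IsGradedSystem A) {c : ℝ}
    (hfin : ∀ m, 1 ≤ m → (A m)ᶜ.Finite)
    (hge : ∀ m, 1 ≤ m → c ≤ ((A m)ᶜ.ncard : ℝ) / (m : ℝ) ^ n)
    (hlim : Tendsto (fun m : ℕ => ((A m)ᶜ.ncard : ℝ) / (m : ℝ) ^ n) atTop (𝓝 c)) :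
    volume (closure (⋂ (m : ℕ) (_ : 1 ≤ m), {x : Fin n → ℝ | ∀ i, 0 ≤ x i} \ ((m : ℝ)⁻¹ •
      convexHull ℝ {x : Fin n → ℝ | ∃ α ∈ A m, ∀ i, (α i : ℝ) ≤ x i}))) = ENNReal.ofReal c := by
  set P : Set (Fin n → ℝ) := ⋃ (m : ℕ) (_ : 1 ≤ m), convexHull ℝ (scaledRegion (A m) m) with hP
  have h1 : (⋂ (m : ℕ) (_ : 1 ≤ m), {x : Fin n → ℝ | ∀ i, 0 ≤ x i} \ ((m : ℝ)⁻¹ •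
      convexHull ℝ {x : Fin n → ℝ | ∃ α ∈ A m, ∀ i, (α i : ℝ) ≤ x i})) = orthant n \ P := by
    have h2 : ∀ m : ℕ, 1 ≤ m → (m : ℝ)⁻¹ •
        convexHull ℝ {x : Fin n → ℝ | ∃ α ∈ A m, ∀ i, (α i : ℝ) ≤ x i} =
          convexHull ℝ (scaledRegion (A m) m) := fun m hm => by
      rw [scaledRegion_eq_smul _ hm, convexHull_smul]
    ext x
    simp only [mem_iInter, Set.mem_sdiff, hP, mem_iUnion, not_exists]
    constructor
    · exact fun h => ⟨(h 1 le_rfl).1, fun m hm => h2 m hm ▸ (h m hm).2⟩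
    · exact fun h m hm => ⟨h.1, h2 m hm ▸ h.2 m hm⟩
  rw [h1, volume_closure_orthant_sdiff (isUpperSet_limitRegion A),
    hA.volume_orthant_sdiff_limitRegion hfin hge hlim]
  · exact iUnion₂_mono fun m _ => subset_convexHull ℝ _
  · refine iUnion₂_subset fun m hm => convexHull_min ?_ hA.convex_closure_limitRegion
    exact (subset_iUnion₂ (s := fun m (_ : 1 ≤ m) => scaledRegion (A m) m) m hm).trans
      subset_closure

end Shape

/-! ### Asymptotics of binomial coefficients -/

section Binomial

open Filter Topology

theorem choose_add_eq_ascFactorial_div (n k : ℕ) :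
    ((n + k).choose n : ℝ) = ((k + 1).ascFactorial n : ℝ) / n ! := by
  rw [eq_div_iff (by positivity), Nat.ascFactorial_eq_factorial_mul_choose, add_comm k n]
  push_cast
  ring

/-- The product `(k+1)(k+2)⋯(k+n)` is at least `(k+1)^n`. Holding for every `k`, this is what bounds
the volume of the limiting shape from below. -/
theorem inv_factorial_le_choose_div (n k : ℕ) :
    1 / (n ! : ℝ) ≤ ((n + k).choose n : ℝ) / ((k + 1 : ℕ) : ℝ) ^ n := by
  rw [choose_add_eq_ascFactorial_div, div_div, div_le_div_iff₀ (by positivity) (by positivity)]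
  have h : (((k + 1) ^ n : ℕ) : ℝ) ≤ ((k + 1).ascFactorial n : ℝ) := by
    exact_mod_cast Nat.pow_succ_le_ascFactorial (k + 1) n
  push_cast at h ⊢
  nlinarith [mul_le_mul_of_nonneg_left h (Nat.cast_nonneg (α := ℝ) n !)]

theorem tendsto_choose_div (n : ℕ) :
    Tendsto (fun k : ℕ => ((n + k).choose n : ℝ) / ((k + 1 : ℕ) : ℝ) ^ n) atTop
      (𝓝 (1 / (n ! : ℝ))) := by
  have hlim : Tendsto (fun k : ℕ => (1 + (n : ℝ) * (1 / ((k : ℝ) + 1))) ^ n * (1 / (n ! : ℝ))) atTop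
      (𝓝 (1 / (n ! : ℝ))) := by
    have h1 := ((tendsto_one_div_add_atTop_nhds_zero_nat (𝕜 := ℝ)).const_mul (n : ℝ)).const_add 1
    have h2 := (h1.pow n).mul_const (1 / (n ! : ℝ))
    simpa using h2
  refine tendsto_of_tendsto_of_tendsto_of_le_of_le tendsto_const_nhds hlim
    (inv_factorial_le_choose_div n) fun k => ?_
  rw [choose_add_eq_ascFactorial_div]
  have h : ((k + 1).ascFactorial n : ℝ) ≤ ((k : ℝ) + 1 + n) ^ n := by
    have h0 : (k + 1).ascFactorial n ≤ (k + 1 + n) ^ n :=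
      (Nat.ascFactorial_le_pow_add k n).trans (Nat.pow_le_pow_left (by omega) n)
    exact_mod_cast h0
  have hk : ((k : ℝ) + 1) ≠ 0 := by positivity
  have h2 : (1 + (n : ℝ) * (1 / ((k : ℝ) + 1))) ^ n = ((k : ℝ) + 1 + n) ^ n / ((k : ℝ) + 1) ^ n := by
    rw [← div_pow]; congr 1; field_simp
  rw [h2, div_div, div_mul_div_comm, mul_one, mul_comm (n ! : ℝ)]
  push_cast
  gcongr

end Binomial

end LimitingShape

end

theorem mainTheorem5 {K : Type*} [Field K] [IsAlgClosed K] [CharZero K] (n r : ℕ)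
    (S : Finset (ℙ K (Fin (n + 1) → K))) (hS : S.card = r) :
    -- the Hilbert polynomials and the generic initial ideals involved exist
    (∀ m : ℕ, 1 ≤ m →
      LimitingShape.IsHilbertPolynomial
          (LimitingShape.symbolicPower (LimitingShape.pointsIdeal S) m)
          (LimitingShape.hilbertPolynomial
            (LimitingShape.symbolicPower (LimitingShape.pointsIdeal S) m)) ∧
        LimitingShape.IsGenericInitialIdeal
          (LimitingShape.symbolicPower (LimitingShape.pointsIdeal S) m)
          (LimitingShape.gin (LimitingShape.symbolicPower (LimitingShape.pointsIdeal S) m))) ∧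
    -- the limit defining `aHP` exists, and equals `r / n!`
    (∀ t : ℝ,
      Filter.Tendsto (LimitingShape.aHPSeq (LimitingShape.pointsIdeal S) t) Filter.atTop
          (nhds (LimitingShape.aHP (LimitingShape.pointsIdeal S) t)) ∧
        LimitingShape.aHP (LimitingShape.pointsIdeal S) t = (r : ℝ) / (n ! : ℝ)) ∧
    MeasureTheory.volume (LimitingShape.Γ (LimitingShape.pointsIdeal S)) =
      ENNReal.ofReal ((r : ℝ) / (n ! : ℝ)) := by
  open LimitingShape in
  subst hS
  have hlim : Filter.Tendsto (fun k : ℕ => ((S.card * (n + k).choose n : ℕ) : ℝ) /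
      ((k + 1 : ℕ) : ℝ) ^ n) Filter.atTop (nhds ((S.card : ℝ) / (n ! : ℝ))) := by
    have h := (tendsto_choose_div n).const_mul (S.card : ℝ)
    rw [mul_one_div] at h
    refine h.congr fun k => ?_
    rw [Nat.cast_mul, mul_div_assoc]
  have hHP : ∀ k, hilbertPolynomial (symbolicPower (pointsIdeal S) (k + 1)) =
      Polynomial.C ((S.card * (n + k).choose n : ℕ) : ℚ) := fun k =>
    hilbertPolynomial_spec (isHilbertPolynomial_symbolicPower S k)
  refine ⟨fun m hm => ⟨?_, gin_spec (isHomog_symbolicPower S m)⟩, fun t => ?_, ?_⟩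
  · obtain ⟨k, rfl⟩ := Nat.exists_eq_add_of_le' hm
    rw [hHP]
    exact isHilbertPolynomial_symbolicPower S k
  · have h : Filter.Tendsto (aHPSeq (pointsIdeal S) t) Filter.atTop
        (nhds ((S.card : ℝ) / (n ! : ℝ))) := by
      -- The Hilbert polynomial is known at `m = k + 1`, hence the shift. It is constant, so `t`
      -- drops out.
      rw [← Filter.tendsto_add_atTop_iff_nat 1]
      refine hlim.congr fun k => ?_
      rw [aHPSeq, hHP, Polynomial.aeval_C, eq_ratCast, Rat.cast_natCast]
    have h2 : aHP (pointsIdeal S) t = (S.card : ℝ) / (n ! : ℝ) := h.limUnder_eq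
    exact ⟨h2 ▸ h, h2⟩
  · have hA : IsGradedSystem (ginExponents S) :=
      ⟨isUpperSet_ginExponents S, fun hα hβ => add_mem_ginExponents S hα hβ⟩
    refine hA.volume_limitingShape (fun m hm => ?_) (fun m hm => ?_) ?_
    · obtain ⟨k, rfl⟩ := Nat.exists_eq_add_of_le' hm
      exact (ncard_compl_ginExponents S k).1
    · obtain ⟨k, rfl⟩ := Nat.exists_eq_add_of_le' hm
      rw [(ncard_compl_ginExponents S k).2, Nat.cast_mul, mul_div_assoc, ← mul_one_div]
      exact mul_le_mul_of_nonneg_left (inv_factorial_le_choose_div n k) (Nat.cast_nonneg _)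
    · rw [← Filter.tendsto_add_atTop_iff_nat 1]
      refine hlim.congr fun k => ?_
      rw [(ncard_compl_ginExponents S k).2]
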